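/- Let $M$ be a smooth manifold of dimension $n\ge 3$ with a smooth Riemannian metric $g$. Let $R(X,Y)Z=\nabla_X\nabla_YZ-\nabla_Y\nabla_XZ-\nabla_{[X,Y]}Z$ be the curvature of its Levi-Civita connection $\nabla$, $Rm(X,Y,Z,W)=g(R(X,Y)Z,W)$, $Ric(Y,Z)=\mathrm{tr}(X\mapsto R(X,Y)Z)$, $S(g)=\mathrm{tr}_g Ric$, and let $$P(g)=\frac{1}{n-2}\Big(Ric(g)-\frac{S(g)}{2(n-1)}\,g\Big)$$ be the Schouten tensor. The metric $g$ is called locally conformally flat if every point of $M$ lies in the domain $U$ of a smooth chart $\varphi:U\to\mathbb R^n$ with $g=e^{2u}\varphi^*\bar g$ on $U$ for some smooth $u:U\to\mathbb R$, where $\bar g$ is the Euclidean metric; such a $\varphi$ is called a conformal chart. For conformal metrics $g_2=e^{2u}g_1$ the Osgood–Stowe tensor is $$\mathrm{OS}(g_2,g_1)=\mathrm{Hess}(u)-du\otimes du-\frac1n\big(\Delta u-|\nabla u|^2\big)g_1,$$ with all operations taken with respect to $g_1$. A pair $(g,B)$, with $B$ a smooth $g$-self-adjoint endomorphism field of $TM$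 and $I\!\!I(X,Y)=g(BX,Y)$, solves the Gauss–Codazzi equations at infinity if $$Rm(g)=-\tfrac12\, g\owedge I\!\!I,\qquad d^{\nabla}B=0,$$ where $(T\owedge S)(X,Y,Z,W)=T(X,W)S(Y,Z)+T(Y,Z)S(X,W)-T(X,Z)S(Y,W)-T(Y,W)S(X,Z)$ and $d^\nabla B(X,Y)=(\nabla_XB)Y-(\nabla_YB)X$. (1) If $g$ is locally conformally flat, then the tensors $\mathrm{OS}(g,\varphi^*\bar g)$, over all conformal charts $\varphi$, agree on overlaps and so define a global tensor $\mathrm{OS}(g)$ on $M$, and $$2\,\mathrm{OS}(g)-\frac{S(g)}{n(n-1)}\,g=-2P(g).$$ (2) The pair $(g,-2P)$, that is, $(g,B)$ with $B=g^{-1}(-2P(g))$ (so $I\!\!I=-2P(g)$), solves the Gauss–Codazzi equations at infinity if and only if $g$ is locally conformally flat. -/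

import Mathlib

open scoped Manifold ContDiff

set_option maxSynthPendingDepth 3

noncomputable section

namespace ConfFlat

/-! ### Riemannian geometry in a coordinate domain

Here `V` is a finite-dimensional model space, `G : V → V →L[ℝ] V →L[ℝ] ℝ` is the coordinate
expression of a metric and everything is computed at a point `x` where `G` is smooth and
nondegenerate. The map `(G x).inverse` is the inverse `g⁻¹ : T* → T` of `v ↦ g(v, ·)`. -/

section Local

variable {V : Type*} [NormedAddCommGroup V] [NormedSpace ℝ V]

/-- The Christoffel symbols of the Levi-Civita connection, as a bilinear map:
`∇_X Y = D_X Y + Γ(X, Y)`; see `christoffel_eq`. -/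
def christoffel (G : V → V →L[ℝ] V →L[ℝ] ℝ) (x : V) : V →L[ℝ] V →L[ℝ] V :=
  let D : V →L[ℝ] V →L[ℝ] V →L[ℝ] ℝ := fderiv ℝ G x
  let D' : V →L[ℝ] V →L[ℝ] V →L[ℝ] ℝ :=
    (ContinuousLinearMap.flipₗᵢ ℝ V V ℝ : (V →L[ℝ] V →L[ℝ] ℝ) →L[ℝ] (V →L[ℝ] V →L[ℝ] ℝ)) ∘L D.flip
  let K : V →L[ℝ] V →L[ℝ] V →L[ℝ] ℝ := (1 / 2 : ℝ) • (D + D.flip - D')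
  (ContinuousLinearMap.compL ℝ V (V →L[ℝ] ℝ) V (G x).inverse) ∘L K

/-- If `G x` is invertible, `Γ(u, v)` is determined by
`g(Γ(u, v), w) = (D_u g(v, w) + D_v g(u, w) - D_w g(u, v)) / 2`. -/
theorem christoffel_eq (G : V → V →L[ℝ] V →L[ℝ] ℝ) (x u v w : V) (h : (G x).IsInvertible) :
    G x (christoffel G x u v) w =
      (1 / 2) * (fderiv ℝ G x u v w + fderiv ℝ G x v u w - fderiv ℝ G x w u v) := by
  obtain ⟨e, he⟩ := h
  simp [christoffel, ← he]

/-- The curvature operator `R(X, Y) Z = ∇_X ∇_Y Z - ∇_Y ∇_X Z - ∇_[X,Y] Z` in coordinates, see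
`curvatureOp_apply`. -/
def curvatureOp (G : V → V →L[ℝ] V →L[ℝ] ℝ) (x : V) : V →L[ℝ] V →L[ℝ] V →L[ℝ] V :=
  let Γ := christoffel G x
  let A := fderiv ℝ (christoffel G) x +
    (ContinuousLinearMap.compL ℝ V V V).bilinearComp Γ Γ
  A - A.flip

theorem curvatureOp_apply (G : V → V →L[ℝ] V →L[ℝ] ℝ) (x u v w : V) :
    curvatureOp G x u v w =
      (fderiv ℝ (christoffel G) x u v w + christoffel G x u (christoffel G x v w)) -
      (fderiv ℝ (christoffel G) x v u w + christoffel G x v (christoffel G x u w)) := by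
  simp [curvatureOp]

/-- The Hessian `Hess(u)(X, Y) = X(Y u) - (∇_X Y) u` of a function. -/
def hessian (G : V → V →L[ℝ] V →L[ℝ] ℝ) (u : V → ℝ) (x : V) : V →L[ℝ] V →L[ℝ] ℝ :=
  fderiv ℝ (fderiv ℝ u) x -
    (ContinuousLinearMap.compL ℝ V V ℝ (fderiv ℝ u x)) ∘L christoffel G x

theorem hessian_apply (G : V → V →L[ℝ] V →L[ℝ] ℝ) (u : V → ℝ) (x v w : V) :
    hessian G u x v w =
      fderiv ℝ (fderiv ℝ u) x v w - fderiv ℝ u x (christoffel G x v w) := by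
  simp [hessian]

/-- The covariant derivative `(∇_X B) Y = ∇_X (B Y) - B (∇_X Y)` of an endomorphism field. -/
def covDerivEnd (G : V → V →L[ℝ] V →L[ℝ] ℝ) (B : V → V →L[ℝ] V) (x X Y : V) : V :=
  fderiv ℝ B x X Y + christoffel G x X (B x Y) - B x (christoffel G x X Y)

variable [FiniteDimensional ℝ V]

/-- The trace of an endomorphism, as a continuous linear map. -/
def traceCLM (V : Type*) [NormedAddCommGroup V] [NormedSpace ℝ V] [FiniteDimensional ℝ V] :
    (V →L[ℝ] V) →L[ℝ] ℝ :=
  LinearMap.toContinuousLinearMap (LinearMap.trace ℝ V ∘ₗ ContinuousLinearMap.coeLM ℝ)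

theorem traceCLM_apply (f : V →L[ℝ] V) :
    traceCLM V f = LinearMap.trace ℝ V (f : V →ₗ[ℝ] V) := rfl

/-- The trace `tr_g T = tr (g⁻¹ T)` of a bilinear form with respect to a metric. -/
def metricTrace (g T : V →L[ℝ] V →L[ℝ] ℝ) : ℝ := traceCLM V (g.inverse ∘L T)

/-- The Ricci tensor `Ric(Y, Z) = tr (X ↦ R(X, Y) Z)`, which is the trace of
`Rm(X, Y, Z, W) = g(R(X, Y) Z, W)` on its first and last indices; see `ricciLoc_apply`. -/
def ricciLoc (G : V → V →L[ℝ] V →L[ℝ] ℝ) (x : V) : V →L[ℝ] V →L[ℝ] ℝ :=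
  (ContinuousLinearMap.compL ℝ V (V →L[ℝ] V) ℝ (traceCLM V)) ∘L
    (ContinuousLinearMap.flipₗᵢ ℝ V V V : (V →L[ℝ] V →L[ℝ] V) →L[ℝ] (V →L[ℝ] V →L[ℝ] V)) ∘L
      (curvatureOp G x).flip

theorem ricciLoc_apply (G : V → V →L[ℝ] V →L[ℝ] ℝ) (x v w : V) :
    ricciLoc G x v w = traceCLM V (((curvatureOp G x).flip v).flip w) := rfl

/-- The scalar curvature, the metric trace of the Ricci tensor. -/
def scalarLoc (G : V → V →L[ℝ] V →L[ℝ] ℝ) (x : V) : ℝ := metricTrace (G x) (ricciLoc G x)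

/-- The Schouten tensor `P = (Ric - S / (2 (n - 1)) g) / (n - 2)`. -/
def schoutenLoc (G : V → V →L[ℝ] V →L[ℝ] ℝ) (x : V) : V →L[ℝ] V →L[ℝ] ℝ :=
  let n : ℝ := Module.finrank ℝ V
  (1 / (n - 2)) • (ricciLoc G x - (scalarLoc G x / (2 * (n - 1))) • G x)

/-- The Osgood-Stowe tensor `OS(e^{2u} g, g)`, the traceless part of `Hess(u) - du ⊗ du`:
`Hess(u) - du ⊗ du - (1/n) (Δu - |∇u|²) g`, all with respect to `g`. -/
def osgoodStoweLoc (G : V → V →L[ℝ] V →L[ℝ] ℝ) (u : V → ℝ) (x : V) : V →L[ℝ] V →L[ℝ] ℝ :=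
  let n : ℝ := Module.finrank ℝ V
  let du := fderiv ℝ u x
  let grad := (G x).inverse du
  hessian G u x - du.smulRight du -
    ((1 / n) * (metricTrace (G x) (hessian G u x) - G x grad grad)) • G x

end Local

/-- The Kulkarni-Nomizu product of two symmetric bilinear forms. -/
def kulkarniNomizu {W : Type*} (T S : W → W → ℝ) (X Y Z U : W) : ℝ :=
  T X U * S Y Z + T Y Z * S X U - T X Z * S Y U - T Y U * S X Z

/-! ### Tensor fields on a manifold

`M` is an `n`-dimensional smooth manifold without boundary. Mathlib's tangent space at `p` is the
model space `ℝⁿ`, identified through the preferred chart `chartAt _ p` at `p`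
(`mfderiv_chartAt_self`), so a tensor at `p` is given by its coordinate expression at the
point in that chart. As usual, for smooth data the tensors below do not depend on the chart used
to compute them. -/

/-- The model space `ℝⁿ`. -/
abbrev Model (n : ℕ) : Type := EuclideanSpace ℝ (Fin n)

section Manifold

variable {n : ℕ} {M : Type*} [TopologicalSpace M] [ChartedSpace (Model n) M]

/-- The tangent space of `M` at `p`. -/
abbrev Tan (n : ℕ) {M : Type*} [TopologicalSpace M] [ChartedSpace (Model n) M] (p : M) : Type :=
  TangentSpace 𝓘(ℝ, Model n) p

theorem mfderiv_chartAt_self [IsManifold 𝓘(ℝ, Model n) ∞ M] (p : M) (v : Model n) :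
    (mfderiv 𝓘(ℝ, Model n) 𝓘(ℝ, Model n) (chartAt (Model n) p) p : Model n →L[ℝ] Model n) v =
      v := by
  have : IsManifold 𝓘(ℝ, Model n) 1 M := IsManifold.of_le (n := ∞) (by norm_cast)
  have h := mfderiv_chartAt_eq_tangentCoordChange (I := 𝓘(ℝ, Model n)) (x := p) (y := p)
    (mem_chart_source _ p)
  have h' : mfderiv 𝓘(ℝ, Model n) 𝓘(ℝ, Model n) (chartAt (Model n) p) p =
      tangentCoordChange 𝓘(ℝ, Model n) p p p := h
  rw [h']
  exact tangentCoordChange_self (I := 𝓘(ℝ, Model n)) (x := p) (z := p) (v := v)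
    (mem_extChartAt_source p)

/-- A field of bilinear forms on the tangent spaces of `M`. -/
abbrev BilinField (n : ℕ) (M : Type*) [TopologicalSpace M] [ChartedSpace (Model n) M] : Type _ :=
  ∀ p : M, Tan n p →L[ℝ] Tan n p →L[ℝ] ℝ

/-- A field of endomorphisms of the tangent spaces of `M`. -/
abbrev EndField (n : ℕ) (M : Type*) [TopologicalSpace M] [ChartedSpace (Model n) M] : Type _ :=
  ∀ p : M, Tan n p →L[ℝ] Tan n p

/-- The coordinate expression of `T` in the chart `φ`, the pullback of `T` by `φ⁻¹`. -/
def BilinField.inChart (T : BilinField n M) (φ : OpenPartialHomeomorph M (Model n)) (y : Model n) :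
    Model n →L[ℝ] Model n →L[ℝ] ℝ :=
  let A : Model n →L[ℝ] Model n := mfderiv 𝓘(ℝ, Model n) 𝓘(ℝ, Model n) φ.symm y
  let t : Model n →L[ℝ] Model n →L[ℝ] ℝ := T (φ.symm y)
  t.bilinearComp A A

/-- The coordinate expression of an endomorphism field in the chart `φ`. -/
def EndField.inChart (B : EndField n M) (φ : OpenPartialHomeomorph M (Model n)) (y : Model n) :
    Model n →L[ℝ] Model n :=
  let A : Model n →L[ℝ] Tan n (φ.symm y) :=
    mfderiv 𝓘(ℝ, Model n) 𝓘(ℝ, Model n) φ.symm y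
  let C : Tan n (φ.symm y) →L[ℝ] Model n :=
    mfderiv 𝓘(ℝ, Model n) 𝓘(ℝ, Model n) φ (φ.symm y)
  C ∘L B (φ.symm y) ∘L A

/-- The curvature `R(X, Y) Z` of the Levi-Civita connection of `g`. -/
def curvature (g : BilinField n M) (p : M) :
    Tan n p →L[ℝ] Tan n p →L[ℝ] Tan n p →L[ℝ] Tan n p :=
  curvatureOp (g.inChart (chartAt (Model n) p)) (chartAt (Model n) p p)

/-- The full curvature tensor `Rm(X, Y, Z, W) = g(R(X, Y) Z, W)`. -/
def Rm (g : BilinField n M) (p : M) (X Y Z W : Tan n p) : ℝ :=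
  g p (curvature g p X Y Z) W

/-- The scalar curvature of `g`. -/
def scalarCurvature (g : BilinField n M) (p : M) : ℝ :=
  scalarLoc (g.inChart (chartAt (Model n) p)) (chartAt (Model n) p p)

/-- The Schouten tensor of `g`. -/
def schouten (g : BilinField n M) : BilinField n M := fun p ↦
  schoutenLoc (g.inChart (chartAt (Model n) p)) (chartAt (Model n) p p)

/-- The Osgood-Stowe tensor `OS(e^{2u} g, g)` at `p`, for `g` and `u` smooth near `p`. -/
def osgoodStowe (g : BilinField n M) (u : M → ℝ) (p : M) : Tan n p →L[ℝ] Tan n p →L[ℝ] ℝ :=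
  osgoodStoweLoc (g.inChart (chartAt (Model n) p)) (u ∘ (chartAt (Model n) p).symm)
    (chartAt (Model n) p p)

/-- The exterior covariant derivative `d^∇ B(X, Y) = (∇_X B) Y - (∇_Y B) X` at `p` of a smooth
endomorphism field, for the Levi-Civita connection of `g`. -/
def extCovDeriv (g : BilinField n M) (B : EndField n M) (p : M) (X Y : Tan n p) : Tan n p :=
  let φ := chartAt (Model n) p
  covDerivEnd (g.inChart φ) (B.inChart φ) (φ p) X Y -
    covDerivEnd (g.inChart φ) (B.inChart φ) (φ p) Y X

/-- The bilinear form `(g B)(X, Y) = g(B X, Y)`. -/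
def lower (g : BilinField n M) (B : EndField n M) : BilinField n M := fun p ↦ g p ∘L B p

/-- The endomorphism field `g⁻¹ T`, given by `T(X, Y) = g((g⁻¹ T) X, Y)`. -/
def raise (g T : BilinField n M) : EndField n M := fun p ↦ (g p).inverse ∘L T p

/-- `(g, B)` solves the Gauss-Codazzi equations at infinity: with `II = g B`,
`Rm(g) = -(1/2) g ∧ II` (Kulkarni-Nomizu product) and `d^∇ B = 0`. -/
structure SolvesGaussCodazziAtInfinity (g : BilinField n M) (B : EndField n M) : Prop where
  gauss : ∀ (p : M) (X Y Z W : Tan n p), Rm g p X Y Z W =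
    -(1 / 2) * kulkarniNomizu (fun v w ↦ g p v w) (fun v w ↦ lower g B p v w) X Y Z W
  codazzi : ∀ (p : M) (X Y : Tan n p), extCovDeriv g B p X Y = 0

/-- The pullback of the Euclidean metric by the chart `φ` (meaningful on `φ.source`). -/
def pullbackEuclidean (φ : OpenPartialHomeomorph M (Model n)) : BilinField n M := fun p ↦
  let A : Model n →L[ℝ] Model n := mfderiv 𝓘(ℝ, Model n) 𝓘(ℝ, Model n) φ p
  let e : Model n →L[ℝ] Model n →L[ℝ] ℝ := innerSL ℝ
  (e.bilinearComp A A : Model n →L[ℝ] Model n →L[ℝ] ℝ)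

/-- `φ` is a smooth chart of `M` on whose domain `g = e^{2u} φ^* ḡ` with `u` smooth and
`ḡ` the Euclidean metric. -/
structure IsConformalChart (g : BilinField n M) (φ : OpenPartialHomeomorph M (Model n))
    (u : M → ℝ) : Prop where
  mem_maximalAtlas : φ ∈ IsManifold.maximalAtlas 𝓘(ℝ, Model n) ∞ M
  smooth : ContMDiffOn 𝓘(ℝ, Model n) 𝓘(ℝ, ℝ) ∞ u φ.source
  conformal : ∀ p ∈ φ.source, g p = Real.exp (2 * u p) • pullbackEuclidean φ p

/-- `g` is locally conformally flat: every point lies in the domain of a chart on which `g` is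
conformal to the pullback of the Euclidean metric. -/
def IsLocallyConformallyFlat (g : BilinField n M) : Prop :=
  ∀ p : M, ∃ φ u, IsConformalChart g φ u ∧ p ∈ φ.source

open Classical in
/-- The Osgood-Stowe tensor `OS(g)` of a locally conformally flat metric: at `p` it is
`OS(g, φ^* ḡ)` for a conformal chart `φ` around `p`. -/
def OS (g : BilinField n M) : BilinField n M := fun p ↦
  if h : ∃ c : OpenPartialHomeomorph M (Model n) × (M → ℝ),
      IsConformalChart g c.1 c.2 ∧ p ∈ c.1.source then
    osgoodStowe (pullbackEuclidean h.choose.1) h.choose.2 p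
  else 0

end Manifold

end ConfFlat

end

/-! Everything is computed in coordinates. For g = e^{2u} ḡ on an open set of Euclidean space, put τ
= ∇²u - du ⊗ ∇u + |∇u|²/2 (`confEnd`), and let τ♭ = ḡ(τ·,·). The curvature operator of g is -(ḡ ∧
τ♭) with its last index raised by ḡ (`IsConfEuclidOn.curvatureOp_eq`). Taking traces shows that the
normalisation of the Schouten tensor is exactly the one giving P = -τ♭, while the Osgood-Stowe
tensor is the trace-free part of τ♭ and S(g) g is a multiple of (tr τ) ḡ. This yields 2 OS -
S/(n(n-1)) g = 2τ♭ = -2P. Since g alone determines S and P, the formula also shows that OS does not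
depend on the conformal chart (`OS_eq`); conformal transition maps need not be studied.

If g is conformally flat, the Gauss equation Rm = g ∧ P is the curvature formula again, and the
Codazzi equation follows from the symmetry of the third derivatives of u (`IsConfEuclidOn.codazzi`).

Conversely, work in a chart and let B be the endomorphism field with g(B·,·) = P. The Gauss and
Codazzi equations, with the symmetry of P, say that the tractor connection on the trivial bundle ℝ ×
V × ℝ is flat (`IsGaussCodazziOn.tractorForm_flat`). The Frobenius theorem
(`exists_solution_of_flat`) then gives a parallel frame, which preserves the Lorentzian tractor
metric. Seen in this frame, the null section (0, 0, 1) becomes a map Z into the light cone of a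
fixed Lorentzian vector space, and Z is isometric for g. Rescaling Z to a flat slice of the cone
changes the induced metric only by a conformal factor, so it gives a local conformal map to flat
space (`IsGaussCodazziOn.exists_conformal_map`). A linear isometry and the inverse function theorem
turn this map into a conformal chart.

Tensors at p are defined through the preferred chart at p. Naturality under local diffeomorphisms
(`IsPullbackOn`) allows them to be computed in any chart of the maximal atlas. -/

noncomputable section

namespace ConfFlat

open MeasureTheory Metric Topology

/-! ### Linear total differential equations dF = θF and the Frobenius theorem -/

section Frobenius

variable {V : Type*} [NormedAddCommGroup V] [NormedSpace ℝ V]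
  {W : Type*} [NormedAddCommGroup W] [NormedSpace ℝ W]

theorem smul_mem_ball_zero {r t : ℝ} {x : V} (ht : t ∈ Set.Icc (0 : ℝ) 1)
    (hx : x ∈ ball (0 : V) r) :
    t • x ∈ ball (0 : V) r := by
  rw [mem_ball_zero_iff] at hx ⊢
  rw [norm_smul, Real.norm_of_nonneg ht.1]
  nlinarith [norm_nonneg x, ht.1, ht.2]

theorem continuousOn_comp_ray {X : Type*} [TopologicalSpace X] {K : V → X} {r : ℝ} {x : V}
    (hK : ContinuousOn K (ball 0 r)) (hx : x ∈ ball (0 : V) r) :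
    ContinuousOn (fun t : ℝ ↦ K (t • x)) (Set.Icc 0 1) :=
  hK.comp (by fun_prop) fun _ ht ↦ smul_mem_ball_zero ht hx

/-- The integral of a one-form along the segment from the origin. -/
def radialIntegral (β : V → V →L[ℝ] W) (x : V) : W := ∫ t in (0 : ℝ)..1, β (t • x) x

/-- The integrand of the derivative of `radialIntegral`. -/
def radialDeriv (β : V → V →L[ℝ] W) (β' : V → V →L[ℝ] V →L[ℝ] W) (x : V) (t : ℝ) : V →L[ℝ] W :=
  β (t • x) + t • (β' (t • x)).flip x

theorem norm_radialDeriv_le {β : V → V →L[ℝ] W} {β' : V → V →L[ℝ] V →L[ℝ] W} {r C C' : ℝ}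
    (hC : ∀ x ∈ ball (0 : V) r, ‖β x‖ ≤ C) (hC' : ∀ x ∈ ball (0 : V) r, ‖β' x‖ ≤ C')
    {x : V} (hx : x ∈ ball (0 : V) r) {t : ℝ} (ht : t ∈ Set.Icc (0 : ℝ) 1) :
    ‖radialDeriv β β' x t‖ ≤ C + r * C' := by
  have hm := smul_mem_ball_zero ht hx
  refine (norm_add_le _ _).trans (add_le_add (hC _ hm) ?_)
  have h1 : ‖(β' (t • x)).flip x‖ ≤ C' * r := by
    refine ((β' (t • x)).flip.le_opNorm x).trans ?_
    rw [ContinuousLinearMap.opNorm_flip]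
    have := hC' _ hm
    rw [mem_ball_zero_iff] at hx
    gcongr
    exact (norm_nonneg _).trans this
  rw [norm_smul, Real.norm_of_nonneg ht.1]
  nlinarith [norm_nonneg ((β' (t • x)).flip x), ht.2, ht.1]

theorem continuousOn_radialDeriv {β : V → V →L[ℝ] W} {β' : V → V →L[ℝ] V →L[ℝ] W} {r : ℝ}
    (hβ : ContinuousOn β (ball 0 r)) (hβ' : ContinuousOn β' (ball 0 r))
    {x : V} (hx : x ∈ ball (0 : V) r) :
    ContinuousOn (radialDeriv β β' x) (Set.Icc 0 1) := by
  have h1 := continuousOn_comp_ray hβ hx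
  have h2 := continuousOn_comp_ray hβ' hx
  have h3 : ContinuousOn (fun t : ℝ ↦ (β' (t • x)).flip) (Set.Icc 0 1) :=
    (ContinuousLinearMap.flipₗᵢ ℝ V V W).continuous.comp_continuousOn h2
  exact h1.add (continuousOn_id.smul (h3.clm_apply continuousOn_const))

theorem hasFDerivAt_radialIntegral {β : V → V →L[ℝ] W}
    {β' : V → V →L[ℝ] V →L[ℝ] W} {r C C' : ℝ}
    (hβ : ∀ x ∈ ball (0 : V) r, HasFDerivAt β (β' x) x) (hβ' : ContinuousOn β' (ball 0 r))
    (hC : ∀ x ∈ ball (0 : V) r, ‖β x‖ ≤ C) (hC' : ∀ x ∈ ball (0 : V) r, ‖β' x‖ ≤ C')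
    {x : V} (hx : x ∈ ball (0 : V) r) :
    HasFDerivAt (radialIntegral β) (∫ t in (0 : ℝ)..1, radialDeriv β β' x t) x := by
  have hβc : ContinuousOn β (ball 0 r) := fun y hy ↦ (hβ y hy).continuousAt.continuousWithinAt
  have hu : Set.uIoc (0 : ℝ) 1 ⊆ Set.Icc 0 1 := by
    rw [Set.uIoc_of_le zero_le_one]; exact Set.Ioc_subset_Icc_self
  have hcont : ∀ y ∈ ball (0 : V) r, ContinuousOn (fun t : ℝ ↦ β (t • y) y) (Set.Icc 0 1) :=
    fun y hy ↦ (continuousOn_comp_ray hβc hy).clm_apply continuousOn_const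
  refine intervalIntegral.hasFDerivAt_integral_of_dominated_of_fderiv_le
    (bound := fun _ ↦ C + r * C') (isOpen_ball.mem_nhds hx) ?_ ?_ ?_ ?_ ?_ ?_
  · filter_upwards [isOpen_ball.mem_nhds hx] with y hy
    exact ((hcont y hy).mono hu).aestronglyMeasurable measurableSet_uIoc
  · exact ContinuousOn.intervalIntegrable (by simpa using hcont x hx)
  · exact ((continuousOn_radialDeriv hβc hβ' hx).mono hu).aestronglyMeasurable measurableSet_uIoc
  · exact .of_forall fun t ht y hy ↦ norm_radialDeriv_le hC hC' hy (hu ht)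
  · simp
  · refine .of_forall fun t ht y hy ↦ ?_
    have h1 : HasFDerivAt (fun y : V ↦ t • y) (t • ContinuousLinearMap.id ℝ V) y :=
      (hasFDerivAt_id y).const_smul t
    have h2 := ((hβ _ (smul_mem_ball_zero (hu ht) hy)).comp y h1).clm_apply (hasFDerivAt_id y)
    refine h2.congr_fderiv ?_
    ext v
    simp [radialDeriv]

theorem continuousOn_integral_radialDeriv {β : V → V →L[ℝ] W}
    {β' : V → V →L[ℝ] V →L[ℝ] W} {r : ℝ}
    (hβ : ContinuousOn β (ball 0 r)) (hβ' : ContinuousOn β' (ball 0 r)) :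
    ContinuousOn (fun x ↦ ∫ t in (0 : ℝ)..1, radialDeriv β β' x t) (ball 0 r) := by
  rw [continuousOn_iff_continuous_domRestrict]
  -- The integrand is controlled only while t • x stays in the ball. Clamping t to [0, 1] makes it
  -- jointly continuous for all real t and leaves the integral unchanged.
  let c : ℝ → ℝ := fun t ↦ max 0 (min 1 t)
  have hc : ∀ t, c t ∈ Set.Icc (0 : ℝ) 1 := fun t ↦ ⟨le_max_left _ _, by simp [c]⟩
  have hcc : Continuous c := by fun_prop
  have hce : ∀ t ∈ Set.uIcc (0 : ℝ) 1, c t = t := by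
    intro t ht
    rw [Set.uIcc_of_le zero_le_one] at ht
    simp [c, ht.1, ht.2]
  have key : Continuous fun x : ball (0 : V) r ↦
      ∫ t in (0 : ℝ)..1, radialDeriv β β' (x : V) (c t) := by
    apply intervalIntegral.continuous_parametric_intervalIntegral_of_continuous'
    have hm : Continuous fun q : ball (0 : V) r × ℝ ↦
        (⟨c q.2 • (q.1 : V), smul_mem_ball_zero (hc _) q.1.2⟩ : ball (0 : V) r) := by
      apply Continuous.subtype_mk; fun_prop
    have h1 := (continuousOn_iff_continuous_domRestrict.1 hβ).comp hm
    have h2 := (ContinuousLinearMap.flipₗᵢ ℝ V V W).continuous.comp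
      ((continuousOn_iff_continuous_domRestrict.1 hβ').comp hm)
    exact h1.add ((hcc.comp continuous_snd).smul (h2.clm_apply (by fun_prop)))
  refine key.congr fun x ↦ ?_
  exact intervalIntegral.integral_congr fun t ht ↦ by simp only [hce t ht]

theorem norm_radialIntegral_le {β : V → V →L[ℝ] W} {r C : ℝ}
    (hC : ∀ x ∈ ball (0 : V) r, ‖β x‖ ≤ C) {x : V} (hx : x ∈ ball (0 : V) r) :
    ‖radialIntegral β x‖ ≤ C * r := by
  have := intervalIntegral.norm_integral_le_of_norm_le_const (a := 0) (b := 1) (C := C * r)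
    (f := fun t : ℝ ↦ β (t • x) x) ?_
  · simpa [radialIntegral] using this
  intro t ht
  rw [Set.uIoc_of_le zero_le_one] at ht
  refine (ContinuousLinearMap.le_opNorm _ _).trans ?_
  have h := hC _ (smul_mem_ball_zero (Set.Ioc_subset_Icc_self ht) hx)
  rw [mem_ball_zero_iff] at hx
  gcongr
  exact (norm_nonneg _).trans h

/-- A radial version of the Poincaré homotopy formula in degree one. -/
theorem integral_radialDeriv_apply [CompleteSpace W] {β : V → V →L[ℝ] W}
    {β' : V → V →L[ℝ] V →L[ℝ] W} {r : ℝ}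
    (hβ : ∀ x ∈ ball (0 : V) r, HasFDerivAt β (β' x) x) (hβ' : ContinuousOn β' (ball 0 r))
    {x : V} (hx : x ∈ ball (0 : V) r) (h : V) :
    (∫ t in (0 : ℝ)..1, radialDeriv β β' x t) h - β x h =
      ∫ t in (0 : ℝ)..1, t • (β' (t • x) h x - β' (t • x) x h) := by
  have hβc : ContinuousOn β (ball 0 r) := fun y hy ↦ (hβ y hy).continuousAt.continuousWithinAt
  have hcd := continuousOn_radialDeriv hβc hβ' hx
  have hI : IntervalIntegrable (radialDeriv β β' x) volume 0 1 :=
    ContinuousOn.intervalIntegrable (by simpa using hcd)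
  have hr := continuousOn_comp_ray hβ' hx
  have hJ : IntervalIntegrable (fun t : ℝ ↦ β (t • x) h + t • β' (t • x) x h) volume 0 1 := by
    apply ContinuousOn.intervalIntegrable
    rw [Set.uIcc_of_le zero_le_one]
    exact ((continuousOn_comp_ray hβc hx).clm_apply continuousOn_const).add
      (continuousOn_id.smul ((hr.clm_apply continuousOn_const).clm_apply continuousOn_const))
  -- The integrand is the derivative of t ↦ t β(tx) h. Subtracting this from the integral of
  -- `radialDeriv` leaves t times the exterior derivative of β.
  have hF : ∫ t in (0 : ℝ)..1, (β (t • x) h + t • β' (t • x) x h) = β x h := by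
    rw [intervalIntegral.integral_eq_sub_of_hasDerivAt (f := fun t : ℝ ↦ t • β (t • x) h) _ hJ]
    · simp
    intro t ht
    rw [Set.uIcc_of_le zero_le_one] at ht
    have h1 : HasDerivAt (fun t : ℝ ↦ t • x) x t := by
      simpa using (hasDerivAt_id t).smul_const x
    have h2 := (hβ _ (smul_mem_ball_zero ht hx)).comp_hasDerivAt t h1
    have h3 := (hasDerivAt_id t).smul (h2.clm_apply (hasDerivAt_const t h))
    refine h3.congr_deriv ?_
    simp [add_comm]
  rw [← hF, ContinuousLinearMap.intervalIntegral_apply hI h,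
    ← intervalIntegral.integral_sub _ hJ]
  · refine intervalIntegral.integral_congr fun t _ ↦ ?_
    simp only [radialDeriv, add_apply, smul_apply,
      ContinuousLinearMap.flip_apply]
    module
  · apply ContinuousOn.intervalIntegrable
    rw [Set.uIcc_of_le zero_le_one]
    exact hcd.clm_apply continuousOn_const

/-- The one-form `h ↦ θ(h) f`. -/
def contractForm (θ : V → V →L[ℝ] W →L[ℝ] W) (f : V → W) (x : V) : V →L[ℝ] W := (θ x).flip (f x)

/-- The derivative of `contractForm θ f`, given the derivatives of `θ` and `f`. -/
def contractFormDeriv (θ : V → V →L[ℝ] W →L[ℝ] W) (θ' : V → V →L[ℝ] V →L[ℝ] W →L[ℝ] W)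
    (f : V → W) (f' : V → V →L[ℝ] W) (x : V) : V →L[ℝ] V →L[ℝ] W :=
  (θ x).flip ∘L f' x +
    (((ContinuousLinearMap.flipₗᵢ ℝ V W W : (V →L[ℝ] W →L[ℝ] W) →L[ℝ] (W →L[ℝ] V →L[ℝ] W)) ∘L
      θ' x).flip (f x))

theorem contractFormDeriv_apply (θ : V → V →L[ℝ] W →L[ℝ] W)
    (θ' : V → V →L[ℝ] V →L[ℝ] W →L[ℝ] W) (f : V → W) (f' : V → V →L[ℝ] W) (x h k : V) :
    contractFormDeriv θ θ' f f' x h k = θ x k (f' x h) + θ' x h k (f x) := by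
  simp [contractFormDeriv]

theorem hasFDerivAt_contractForm {θ : V → V →L[ℝ] W →L[ℝ] W}
    {θ' : V → V →L[ℝ] V →L[ℝ] W →L[ℝ] W} {f : V → W} {f' : V → V →L[ℝ] W} {x : V}
    (hθ : HasFDerivAt θ (θ' x) x) (hf : HasFDerivAt f (f' x) x) :
    HasFDerivAt (contractForm θ f) (contractFormDeriv θ θ' f f' x) x := by
  have h1 := (ContinuousLinearMap.hasFDerivAt
    (ContinuousLinearMap.flipₗᵢ ℝ V W W : (V →L[ℝ] W →L[ℝ] W) →L[ℝ] (W →L[ℝ] V →L[ℝ] W))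
    (x := θ x)).comp x hθ
  exact h1.clm_apply hf

theorem norm_contractForm_le {θ : V → V →L[ℝ] W →L[ℝ] W} {f : V → W} {x : V} {m c : ℝ}
    (hθ : ‖θ x‖ ≤ m) (hf : ‖f x‖ ≤ c) : ‖contractForm θ f x‖ ≤ m * c := by
  refine ((θ x).flip.le_opNorm (f x)).trans ?_
  rw [ContinuousLinearMap.opNorm_flip]
  gcongr
  exact (norm_nonneg _).trans hθ

theorem norm_contractFormDeriv_le {θ : V → V →L[ℝ] W →L[ℝ] W}
    {θ' : V → V →L[ℝ] V →L[ℝ] W →L[ℝ] W} {f : V → W} {f' : V → V →L[ℝ] W} {x : V}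
    {m m' c d : ℝ} (hθ : ‖θ x‖ ≤ m) (hθ' : ‖θ' x‖ ≤ m') (hf : ‖f x‖ ≤ c) (hf' : ‖f' x‖ ≤ d) :
    ‖contractFormDeriv θ θ' f f' x‖ ≤ m * d + m' * c := by
  have hm := (norm_nonneg _).trans hθ
  have hm' := (norm_nonneg _).trans hθ'
  have hc := (norm_nonneg _).trans hf
  have hd := (norm_nonneg _).trans hf'
  refine ContinuousLinearMap.opNorm_le_bound₂ _ (by positivity) fun h k ↦ ?_
  rw [contractFormDeriv_apply]
  refine (norm_add_le _ _).trans ?_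
  have h1 : ‖θ x k (f' x h)‖ ≤ m * ‖k‖ * (d * ‖h‖) :=
    ((θ x).le_opNorm₂ k _).trans (by
      gcongr
      exact (f' x).le_of_opNorm_le hf' h)
  have h2 : ‖θ' x h k (f x)‖ ≤ m' * ‖h‖ * ‖k‖ * c := by
    refine (ContinuousLinearMap.le_opNorm₂ _ _ _).trans ?_
    gcongr
    exact (θ' x).le_of_opNorm_le hθ' h
  linarith

theorem continuousOn_contractFormDeriv {θ : V → V →L[ℝ] W →L[ℝ] W}
    {θ' : V → V →L[ℝ] V →L[ℝ] W →L[ℝ] W} {f : V → W} {f' : V → V →L[ℝ] W} {s : Set V}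
    (hθ : ContinuousOn θ s) (hθ' : ContinuousOn θ' s) (hf : ContinuousOn f s)
    (hf' : ContinuousOn f' s) : ContinuousOn (contractFormDeriv θ θ' f f') s := by
  have h1 : ContinuousOn (fun x ↦ (θ x).flip) s :=
    (ContinuousLinearMap.flipₗᵢ ℝ V W W).continuous.comp_continuousOn hθ
  have h2 : ContinuousOn (fun x ↦ ((ContinuousLinearMap.flipₗᵢ ℝ V W W :
      (V →L[ℝ] W →L[ℝ] W) →L[ℝ] (W →L[ℝ] V →L[ℝ] W)) ∘L θ' x).flip) s :=
    (ContinuousLinearMap.flipₗᵢ ℝ V W (V →L[ℝ] W)).continuous.comp_continuousOn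
      (continuousOn_const.clm_comp hθ')
  exact (h1.clm_comp hf').add (h2.clm_apply hf)

/-- The terms of the path-ordered exponential of `θ` along rays, applied to `w`. -/
def dysonTerm (θ : V → V →L[ℝ] W →L[ℝ] W) (w : W) : ℕ → V → W
  | 0 => fun _ ↦ w
  | k + 1 => radialIntegral (contractForm θ (dysonTerm θ w k))

/-- The derivatives of the terms of the path-ordered exponential. -/
def dysonDeriv (θ : V → V →L[ℝ] W →L[ℝ] W) (θ' : V → V →L[ℝ] V →L[ℝ] W →L[ℝ] W) (w : W) :
    ℕ → V → V →L[ℝ] W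
  | 0 => 0
  | k + 1 => fun x ↦ ∫ t in (0 : ℝ)..1, radialDeriv (contractForm θ (dysonTerm θ w k))
      (contractFormDeriv θ θ' (dysonTerm θ w k) (dysonDeriv θ θ' w k)) x t

/-- Each radial integration costs a factor at most m r ≤ 1/4, so the terms decay geometrically. In
the derivative bound the constant 4 closes the induction: with K = (m + r m')‖w‖, the next
derivative is at most (1 + 4 m r) K (1/2)^k ≤ 2 K (1/2)^k, which is 4 K (1/2)^(k+1). -/
theorem dysonTerm_spec {θ : V → V →L[ℝ] W →L[ℝ] W}
    {θ' : V → V →L[ℝ] V →L[ℝ] W →L[ℝ] W} {r m m' : ℝ} (hr : 0 < r) (hm : 0 ≤ m) (hm' : 0 ≤ m')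
    (hmr : m * r ≤ 1 / 4)
    (hθ : ∀ x ∈ ball (0 : V) r, HasFDerivAt θ (θ' x) x) (hθ' : ContinuousOn θ' (ball 0 r))
    (hbθ : ∀ x ∈ ball (0 : V) r, ‖θ x‖ ≤ m) (hbθ' : ∀ x ∈ ball (0 : V) r, ‖θ' x‖ ≤ m') (w : W)
    (k : ℕ) :
    (∀ x ∈ ball (0 : V) r, HasFDerivAt (dysonTerm θ w k) (dysonDeriv θ θ' w k x) x) ∧
    ContinuousOn (dysonDeriv θ θ' w k) (ball 0 r) ∧
    (∀ x ∈ ball (0 : V) r, ‖dysonTerm θ w k x‖ ≤ ‖w‖ * (1 / 2) ^ k) ∧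
    (∀ x ∈ ball (0 : V) r, ‖dysonDeriv θ θ' w k x‖ ≤ 4 * (m + r * m') * ‖w‖ * (1 / 2) ^ k) := by
  induction k with
  | zero =>
    refine ⟨fun x _ ↦ hasFDerivAt_const w x, continuousOn_const, by simp [dysonTerm], ?_⟩
    intro x _
    simp only [dysonDeriv, Pi.zero_apply, norm_zero]
    positivity
  | succ k ih =>
    obtain ⟨h1, h2, h3, h4⟩ := ih
    have hθc : ContinuousOn θ (ball 0 r) := fun y hy ↦ (hθ y hy).continuousAt.continuousWithinAt
    have hfc : ContinuousOn (dysonTerm θ w k) (ball 0 r) :=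
      fun y hy ↦ (h1 y hy).continuousAt.continuousWithinAt
    have hβ : ∀ x ∈ ball (0 : V) r, HasFDerivAt (contractForm θ (dysonTerm θ w k))
        (contractFormDeriv θ θ' (dysonTerm θ w k) (dysonDeriv θ θ' w k) x) x :=
      fun x hx ↦ hasFDerivAt_contractForm (hθ x hx) (h1 x hx)
    have hβ' := continuousOn_contractFormDeriv hθc hθ' hfc h2
    have hβc : ContinuousOn (contractForm θ (dysonTerm θ w k)) (ball 0 r) :=
      fun y hy ↦ (hβ y hy).continuousAt.continuousWithinAt
    have hC := fun x hx ↦ norm_contractForm_le (hbθ x hx) (h3 x hx)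
    have hC' := fun x hx ↦ norm_contractFormDeriv_le (hbθ x hx) (hbθ' x hx) (h3 x hx) (h4 x hx)
    have hp : 0 < (1 / 2 : ℝ) ^ k := by positivity
    refine ⟨fun x hx ↦ hasFDerivAt_radialIntegral hβ hβ' hC hC' hx,
      continuousOn_integral_radialDeriv hβc hβ', fun x hx ↦ ?_, fun x hx ↦ ?_⟩
    · refine (norm_radialIntegral_le hC hx).trans ?_
      rw [pow_succ]
      have : 0 ≤ ‖w‖ * (1 / 2) ^ k := by positivity
      nlinarith
    · have := intervalIntegral.norm_integral_le_of_norm_le_const (a := 0) (b := 1)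
        (f := radialDeriv (contractForm θ (dysonTerm θ w k))
          (contractFormDeriv θ θ' (dysonTerm θ w k) (dysonDeriv θ θ' w k)) x)
        (fun t ht ↦ norm_radialDeriv_le hC hC' hx (by
          rw [Set.uIoc_of_le zero_le_one] at ht; exact Set.Ioc_subset_Icc_self ht))
      refine this.trans ?_
      rw [pow_succ]
      generalize (1 / 2 : ℝ) ^ k = p at hp
      have h5 : 0 ≤ (m + r * m') * ‖w‖ * p := by positivity
      have : r * (m * (4 * (m + r * m') * ‖w‖ * p)) =
        (m * r) * (4 * ((m + r * m') * ‖w‖ * p)) := by ring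
      rw [sub_zero, abs_one, mul_one, mul_add, this]
      nlinarith

/-- Summing the Dyson series solves the integral equation along every ray, with no flatness
assumption. The uniform bounds on F and F' are what the uniqueness argument for the defect F' - θF
starts from. -/
theorem exists_radial_solution [CompleteSpace W] {θ : V → V →L[ℝ] W →L[ℝ] W}
    {θ' : V → V →L[ℝ] V →L[ℝ] W →L[ℝ] W} {r m m' : ℝ} (hr : 0 < r) (hm : 0 ≤ m) (hm' : 0 ≤ m')
    (hmr : m * r ≤ 1 / 4)
    (hθ : ∀ x ∈ ball (0 : V) r, HasFDerivAt θ (θ' x) x) (hθ' : ContinuousOn θ' (ball 0 r))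
    (hbθ : ∀ x ∈ ball (0 : V) r, ‖θ x‖ ≤ m) (hbθ' : ∀ x ∈ ball (0 : V) r, ‖θ' x‖ ≤ m') (w : W) :
    ∃ (F : V → W) (F' : V → V →L[ℝ] W) (c c' : ℝ),
      (∀ x ∈ ball (0 : V) r, HasFDerivAt F (F' x) x) ∧ ContinuousOn F' (ball 0 r) ∧
      (∀ x ∈ ball (0 : V) r, ‖F x‖ ≤ c) ∧ (∀ x ∈ ball (0 : V) r, ‖F' x‖ ≤ c') ∧
      ∀ x ∈ ball (0 : V) r, F x = w + radialIntegral (contractForm θ F) x := by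
  have hs := dysonTerm_spec hr hm hm' hmr hθ hθ' hbθ hbθ' w
  have hsum : ∀ c : ℝ, Summable fun k : ℕ ↦ c * (1 / 2 : ℝ) ^ k :=
    fun c ↦ summable_geometric_two.mul_left c
  have h0 : (0 : V) ∈ ball (0 : V) r := mem_ball_self hr
  have hS : ∀ x ∈ ball (0 : V) r, Summable fun k ↦ dysonTerm θ w k x := fun x hx ↦
    .of_norm_bounded (hsum ‖w‖) fun k ↦ (hs k).2.2.1 x hx
  refine ⟨fun x ↦ ∑' k, dysonTerm θ w k x, fun x ↦ ∑' k, dysonDeriv θ θ' w k x,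
    ∑' k : ℕ, ‖w‖ * (1 / 2 : ℝ) ^ k, ∑' k : ℕ, 4 * (m + r * m') * ‖w‖ * (1 / 2 : ℝ) ^ k,
    fun x hx ↦ ?_, ?_, fun x hx ↦ ?_, fun x hx ↦ ?_, fun x hx ↦ ?_⟩
  · exact hasFDerivAt_tsum_of_isPreconnected (hsum _) isOpen_ball
      (convex_ball _ _).isPreconnected (fun k ↦ (hs k).1) (fun k ↦ (hs k).2.2.2) h0 (hS 0 h0) hx
  · exact continuousOn_tsum (fun k ↦ (hs k).2.1) (hsum _) fun k ↦ (hs k).2.2.2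
  · exact tsum_of_norm_bounded (hsum _).hasSum fun k ↦ (hs k).2.2.1 x hx
  · exact tsum_of_norm_bounded (hsum _).hasSum fun k ↦ (hs k).2.2.2 x hx
  · have hθc : ContinuousOn θ (ball 0 r) := fun y hy ↦ (hθ y hy).continuousAt.continuousWithinAt
    have hu : Set.uIoc (0 : ℝ) 1 ⊆ Set.Icc 0 1 := by
      rw [Set.uIoc_of_le zero_le_one]; exact Set.Ioc_subset_Icc_self
    have key : HasSum (fun k ↦ dysonTerm θ w (k + 1) x)
        (radialIntegral (contractForm θ fun x ↦ ∑' k, dysonTerm θ w k x) x) := by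
      refine intervalIntegral.hasSum_integral_of_dominated_convergence
        (fun k _ ↦ m * (‖w‖ * (1 / 2) ^ k) * ‖x‖) (fun k ↦ ?_) (fun k ↦ ?_) ?_ ?_ ?_
      · have hc : ContinuousOn (contractForm θ (dysonTerm θ w k)) (ball 0 r) := fun y hy ↦
          (hasFDerivAt_contractForm (hθ y hy) ((hs k).1 y hy)).continuousAt.continuousWithinAt
        exact (((continuousOn_comp_ray hc hx).clm_apply continuousOn_const).mono
          hu).aestronglyMeasurable measurableSet_uIoc
      · refine .of_forall fun t ht ↦ ?_
        have hmem := smul_mem_ball_zero (hu ht) hx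
        exact ContinuousLinearMap.le_of_opNorm_le _
          (norm_contractForm_le (hbθ _ hmem) ((hs k).2.2.1 _ hmem)) x
      · exact .of_forall fun t ht ↦ ((hsum ‖w‖).mul_left m).mul_right _
      · simp
      · refine .of_forall fun t ht ↦ ?_
        have hmem := smul_mem_ball_zero (hu ht) hx
        exact (hS _ hmem).hasSum.mapL (θ (t • x) x)
    exact (hS x hx).tsum_eq_zero_add.trans (by rw [key.tsum_eq]; rfl)

/-- A linear total differential equation `dF = θ F` with symmetric second derivatives can be solved
in a ball of radius depending on bounds for `θ` only. -/
theorem exists_hasFDerivAt_ball_zero [CompleteSpace W] {θ : V → V →L[ℝ] W →L[ℝ] W}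
    {θ' : V → V →L[ℝ] V →L[ℝ] W →L[ℝ] W} {r m m' : ℝ} (hr : 0 < r) (hm : 0 ≤ m) (hm' : 0 ≤ m')
    (hmr : m * r ≤ 1 / 4)
    (hθ : ∀ x ∈ ball (0 : V) r, HasFDerivAt θ (θ' x) x) (hθ' : ContinuousOn θ' (ball 0 r))
    (hbθ : ∀ x ∈ ball (0 : V) r, ‖θ x‖ ≤ m) (hbθ' : ∀ x ∈ ball (0 : V) r, ‖θ' x‖ ≤ m')
    (hflat : ∀ x ∈ ball (0 : V) r, ∀ h k z, θ' x h k z + θ x k (θ x h z) =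
      θ' x k h z + θ x h (θ x k z)) (w : W) :
    ∃ F : V → W, F 0 = w ∧ ∀ x ∈ ball (0 : V) r, HasFDerivAt F ((θ x).flip (F x)) x := by
  obtain ⟨F, F', c, c', hF, hF'c, hbF, hbF', heq⟩ :=
    exists_radial_solution hr hm hm' hmr hθ hθ' hbθ hbθ' w
  have h0 : (0 : V) ∈ ball (0 : V) r := mem_ball_self hr
  refine ⟨F, by simp [heq 0 h0, radialIntegral], ?_⟩
  have hθc : ContinuousOn θ (ball 0 r) := fun y hy ↦ (hθ y hy).continuousAt.continuousWithinAt
  have hFc : ContinuousOn F (ball 0 r) := fun y hy ↦ (hF y hy).continuousAt.continuousWithinAt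
  have hβ : ∀ x ∈ ball (0 : V) r, HasFDerivAt (contractForm θ F)
      (contractFormDeriv θ θ' F F' x) x := fun x hx ↦ hasFDerivAt_contractForm (hθ x hx) (hF x hx)
  have hβ' := continuousOn_contractFormDeriv hθc hθ' hFc hF'c
  have hC := fun x hx ↦ norm_contractForm_le (hbθ x hx) (hbF x hx)
  have hC' := fun x hx ↦ norm_contractFormDeriv_le (hbθ x hx) (hbθ' x hx) (hbF x hx) (hbF' x hx)
  have hF'eq : ∀ x ∈ ball (0 : V) r, F' x =
      ∫ t in (0 : ℝ)..1, radialDeriv (contractForm θ F) (contractFormDeriv θ θ' F F') x t := by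
    intro x hx
    refine (hF x hx).unique ?_
    refine ((hasFDerivAt_radialIntegral hβ hβ' hC hC' hx).const_add w).congr_of_eventuallyEq ?_
    filter_upwards [isOpen_ball.mem_nhds hx] with y hy using heq y hy
  -- Apply the homotopy formula to β = θF. Flatness replaces the antisymmetrised derivative of θ by
  -- a commutator of values of θ, so that F' enters only through the defect D = F' - θF. Thus D
  -- solves a homogeneous linear integral equation.
  have hD : ∀ x ∈ ball (0 : V) r, ∀ h, (F' x - contractForm θ F x) h =
      ∫ t in (0 : ℝ)..1, t • (θ (t • x) x ((F' (t • x) - contractForm θ F (t • x)) h) -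
        θ (t • x) h ((F' (t • x) - contractForm θ F (t • x)) x)) := by
    intro x hx h
    rw [sub_apply]
    nth_rewrite 1 [hF'eq x hx]
    rw [integral_radialDeriv_apply hβ hβ' hx]
    refine intervalIntegral.integral_congr fun t ht ↦ ?_
    rw [Set.uIcc_of_le zero_le_one] at ht
    have hfl := hflat _ (smul_mem_ball_zero ht hx) h x (F (t • x))
    simp only [contractFormDeriv_apply, contractForm, sub_apply,
      ContinuousLinearMap.flip_apply, map_sub]
    congr 1
    rw [← sub_eq_zero] at hfl ⊢
    rw [← hfl]
    abel
  -- The integral equation for D has norm at most 2 m r ≤ 1/2, so each use of it halves the bound.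
  -- Letting k tend to infinity gives D = 0.
  have hbound : ∀ k : ℕ, ∀ x ∈ ball (0 : V) r,
      ‖F' x - contractForm θ F x‖ ≤ (c' + m * c) * (1 / 2) ^ k := by
    intro k
    induction k with
    | zero =>
      intro x hx
      simpa using (norm_sub_le _ _).trans (add_le_add (hbF' x hx) (hC x hx))
    | succ k ih =>
      intro x hx
      have hd := (norm_nonneg _).trans (ih x hx)
      refine ContinuousLinearMap.opNorm_le_bound _ (by
        rw [pow_succ, ← mul_assoc]; positivity) fun h ↦ ?_
      rw [hD x hx h]
      have := intervalIntegral.norm_integral_le_of_norm_le_const (a := 0) (b := 1)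
        (f := fun t : ℝ ↦ t • (θ (t • x) x ((F' (t • x) - contractForm θ F (t • x)) h) -
          θ (t • x) h ((F' (t • x) - contractForm θ F (t • x)) x)))
        (C := 2 * (m * r) * ((c' + m * c) * (1 / 2) ^ k) * ‖h‖) ?_
      · refine this.trans ?_
        rw [sub_zero, abs_one, mul_one, pow_succ]
        have : 0 ≤ (c' + m * c) * (1 / 2) ^ k * ‖h‖ := by positivity
        nlinarith
      · intro t ht
        rw [Set.uIoc_of_le zero_le_one] at ht
        have hmem := smul_mem_ball_zero (Set.Ioc_subset_Icc_self ht) hx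
        set d := (c' + m * c) * (1 / 2) ^ k
        have hx' : ‖x‖ ≤ r := (mem_ball_zero_iff.1 hx).le
        have e1 : ∀ a b : V, ‖θ (t • x) a ((F' (t • x) - contractForm θ F (t • x)) b)‖ ≤
            m * ‖a‖ * (d * ‖b‖) := fun a b ↦ by
          refine (ContinuousLinearMap.le_opNorm₂ _ _ _).trans ?_
          gcongr
          · exact hbθ _ hmem
          · exact ContinuousLinearMap.le_of_opNorm_le _ (ih _ hmem) b
        rw [norm_smul, Real.norm_of_nonneg ht.1.le]
        have e2 := (norm_sub_le _ _).trans (add_le_add (e1 x h) (e1 h x))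
        have e3 : m * ‖x‖ * (d * ‖h‖) + m * ‖h‖ * (d * ‖x‖) ≤ 2 * (m * r) * d * ‖h‖ := by
          have : m * ‖x‖ * (d * ‖h‖) ≤ m * r * (d * ‖h‖) := by gcongr
          linarith
        exact (mul_le_of_le_one_left (norm_nonneg _) ht.2).trans (e2.trans e3)
  intro x hx
  have hz : ‖F' x - contractForm θ F x‖ ≤ 0 := by
    refine ge_of_tendsto' (x := Filter.atTop) (f := fun k : ℕ ↦ (c' + m * c) * (1 / 2 : ℝ) ^ k) ?_
      fun k ↦ hbound k x hx
    simpa using (tendsto_pow_atTop_nhds_zero_of_lt_one (by norm_num : (0 : ℝ) ≤ 1 / 2)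
      (by norm_num)).const_mul (c' + m * c)
  have := sub_eq_zero.1 (norm_le_zero_iff.1 hz)
  have hres := hF x hx
  rw [this] at hres
  exact hres

/-- Solutions of a linear total differential equation with smooth coefficients are smooth. -/
theorem contDiffOn_of_hasFDerivAt_flip {θ : V → V →L[ℝ] W →L[ℝ] W} {s : Set V} (hs : IsOpen s)
    (hθ : ContDiffOn ℝ ∞ θ s) {F : V → W}
    (hF : ∀ x ∈ s, HasFDerivAt F ((θ x).flip (F x)) x) : ContDiffOn ℝ ∞ F s := by
  have hflip : ContDiffOn ℝ ∞ (fun x ↦ (θ x).flip) s :=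
    (ContinuousLinearMap.flipₗᵢ ℝ V W W).contDiff.comp_contDiffOn hθ
  rw [contDiffOn_infty]
  intro k
  -- Bootstrap: the equation expresses the derivative of F through θ and F, so F of class C^k has a
  -- derivative of class C^k.
  induction k with
  | zero =>
    exact contDiffOn_zero.2 fun x hx ↦ (hF x hx).continuousAt.continuousWithinAt
  | succ k ih =>
    have := (contDiffOn_succ_iff_fderiv_of_isOpen (n := (k : ℕ∞ω)) (f := F) hs).2
      ⟨fun x hx ↦ (hF x hx).differentiableAt.differentiableWithinAt, by simp, ?_⟩
    · exact_mod_cast this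
    · exact ((hflip.of_le (by exact_mod_cast le_top)).clm_apply ih).congr fun x hx ↦
        (hF x hx).fderiv

/-- **Frobenius theorem** for linear total differential equations: if
`D_h θ(k) + θ(k) θ(h)` is symmetric in `h, k`, then `dF = θ F` has a smooth solution
near every point for every initial value. -/
theorem exists_solution_of_flat [CompleteSpace W] {θ : V → V →L[ℝ] W →L[ℝ] W} {Ω : Set V}
    (hΩ : IsOpen Ω) (hθ : ContDiffOn ℝ ∞ θ Ω)
    (hflat : ∀ x ∈ Ω, ∀ h k z, fderiv ℝ θ x h k z + θ x k (θ x h z) =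
      fderiv ℝ θ x k h z + θ x h (θ x k z)) {x₀ : V} (hx₀ : x₀ ∈ Ω) (w : W) :
    ∃ r > 0, ball x₀ r ⊆ Ω ∧ ∃ F : V → W, F x₀ = w ∧ ContDiffOn ℝ ∞ F (ball x₀ r) ∧
      ∀ x ∈ ball x₀ r, HasFDerivAt F ((θ x).flip (F x)) x := by
  have hθx : ContinuousAt θ x₀ := (hθ.contDiffAt (hΩ.mem_nhds hx₀)).continuousAt
  have hd : ContDiffOn ℝ ∞ (fderiv ℝ θ) Ω := ((contDiffOn_infty_iff_fderiv_of_isOpen hΩ).1 hθ).2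
  have hdx : ContinuousAt (fderiv ℝ θ) x₀ := (hd.contDiffAt (hΩ.mem_nhds hx₀)).continuousAt
  have h1 : ∀ᶠ x in 𝓝 x₀, x ∈ Ω ∧ ‖θ x‖ < ‖θ x₀‖ + 1 ∧ ‖fderiv ℝ θ x‖ < ‖fderiv ℝ θ x₀‖ + 1 :=
    (hΩ.eventually_mem hx₀).and ((hθx.norm.eventually_lt continuousAt_const (by simp)).and
      (hdx.norm.eventually_lt continuousAt_const (by simp)))
  obtain ⟨r₀, hr₀, hball⟩ := Metric.eventually_nhds_iff_ball.1 h1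
  set m := ‖θ x₀‖ + 1
  set m' := ‖fderiv ℝ θ x₀‖ + 1
  have hm : 0 < m := by positivity
  -- Continuity bounds θ and its derivative by m and m' near x₀; shrinking the ball then makes m r
  -- small enough for the series and the uniqueness argument.
  obtain ⟨r, hr, hrr₀, hmr⟩ : ∃ r > 0, r ≤ r₀ ∧ m * r ≤ 1 / 4 := by
    refine ⟨min r₀ (1 / (4 * m)), by positivity, min_le_left _ _, ?_⟩
    calc m * min r₀ (1 / (4 * m)) ≤ m * (1 / (4 * m)) := by gcongr; exact min_le_right _ _
      _ = 1 / 4 := by field_simp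
  have hsub : ball x₀ r ⊆ Ω := fun x hx ↦ (hball x (ball_subset_ball hrr₀ hx)).1
  have htr : ∀ y ∈ ball (0 : V) r, y + x₀ ∈ ball x₀ r := fun y hy ↦ by
    simpa [mem_ball, dist_eq_norm] using hy
  obtain ⟨F, hF0, hF⟩ := exists_hasFDerivAt_ball_zero (θ := fun y ↦ θ (y + x₀))
    (θ' := fun y ↦ fderiv ℝ θ (y + x₀)) hr hm.le (by positivity : (0 : ℝ) ≤ m') hmr
    (fun y hy ↦ by
      have := ((hθ.contDiffAt (hΩ.mem_nhds (hsub (htr y hy)))).differentiableAt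
        (by simp)).hasFDerivAt
      exact (hasFDerivAt_comp_add_right x₀).2 this)
    (hd.continuousOn.comp (by fun_prop) fun y hy ↦ hsub (htr y hy))
    (fun y hy ↦ (hball _ (ball_subset_ball hrr₀ (htr y hy))).2.1.le)
    (fun y hy ↦ (hball _ (ball_subset_ball hrr₀ (htr y hy))).2.2.le)
    (fun y hy ↦ hflat _ (hsub (htr y hy))) w
  have hF' : ∀ x ∈ ball x₀ r, HasFDerivAt (fun x ↦ F (x - x₀)) ((θ x).flip (F (x - x₀))) x := by
    intro x hx
    have hx' : x - x₀ ∈ ball (0 : V) r := by simpa [mem_ball, dist_eq_norm] using hx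
    have := (hasFDerivAt_comp_sub x₀).2 (hF _ hx')
    simpa using this
  exact ⟨r, hr, hsub, fun x ↦ F (x - x₀), by simpa using hF0,
    contDiffOn_of_hasFDerivAt_flip isOpen_ball (hθ.mono hsub) hF', hF'⟩

end Frobenius

end ConfFlat

end

noncomputable section

namespace ConfFlat

open Topology

/-! ### The Levi-Civita connection and curvature in coordinates -/

section LocalGeometry

variable {V : Type*} [NormedAddCommGroup V] [NormedSpace ℝ V]

section Calculus

variable {E F G' : Type*} [NormedAddCommGroup E] [NormedSpace ℝ E] [NormedAddCommGroup F]
  [NormedSpace ℝ F] [NormedAddCommGroup G'] [NormedSpace ℝ G']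

theorem fderiv_clm_apply_apply {A : V → E →L[ℝ] F} {a : V → E} {x : V}
    (hA : DifferentiableAt ℝ A x) (ha : DifferentiableAt ℝ a x) (h : V) :
    fderiv ℝ (fun y ↦ A y (a y)) x h = fderiv ℝ A x h (a x) + A x (fderiv ℝ a x h) := by
  rw [fderiv_clm_apply hA ha]
  simp [add_comm]

theorem fderiv_bilin_apply {T : V → E →L[ℝ] F →L[ℝ] G'} {a : V → E} {b : V → F} {x : V}
    (hT : DifferentiableAt ℝ T x) (ha : DifferentiableAt ℝ a x) (hb : DifferentiableAt ℝ b x)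
    (h : V) : fderiv ℝ (fun y ↦ T y (a y) (b y)) x h =
      fderiv ℝ T x h (a x) (b x) + T x (fderiv ℝ a x h) (b x) + T x (a x) (fderiv ℝ b x h) := by
  rw [fderiv_clm_apply_apply (hT.clm_apply ha) hb, fderiv_clm_apply_apply hT ha]
  simp

theorem fderiv_apply_const {A : V → E →L[ℝ] F} {x : V} (hA : DifferentiableAt ℝ A x) (a : E)
    (h : V) : fderiv ℝ (fun y ↦ A y a) x h = fderiv ℝ A x h a := by
  rw [fderiv_clm_apply_apply hA (differentiableAt_const a)]
  simp

theorem fderiv_apply_const₂ {T : V → E →L[ℝ] F →L[ℝ] G'} {x : V} (hT : DifferentiableAt ℝ T x)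
    (a : E) (b : F) (h : V) : fderiv ℝ (fun y ↦ T y a b) x h = fderiv ℝ T x h a b := by
  rw [fderiv_bilin_apply hT (differentiableAt_const a) (differentiableAt_const b)]
  simp

theorem contDiffOn_fderiv {f : V → E} {Ω : Set V} (hΩ : IsOpen Ω) (hf : ContDiffOn ℝ ∞ f Ω) :
    ContDiffOn ℝ ∞ (fderiv ℝ f) Ω := ((contDiffOn_infty_iff_fderiv_of_isOpen hΩ).1 hf).2

theorem differentiableAt_of_contDiffOn {f : V → E} {Ω : Set V} (hΩ : IsOpen Ω)
    (hf : ContDiffOn ℝ ∞ f Ω) {x : V} (hx : x ∈ Ω) : DifferentiableAt ℝ f x :=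
  (hf.contDiffAt (hΩ.mem_nhds hx)).differentiableAt (by simp)

theorem second_fderiv_symm {f : V → E} {Ω : Set V} (hΩ : IsOpen Ω) (hf : ContDiffOn ℝ ∞ f Ω)
    {x : V} (hx : x ∈ Ω) (u v : V) :
    fderiv ℝ (fderiv ℝ f) x u v = fderiv ℝ (fderiv ℝ f) x v u :=
  ((hf.contDiffAt (hΩ.mem_nhds hx)).isSymmSndFDerivAt (by
    simp only [minSmoothness_of_isRCLikeNormedField]; exact ENat.LEInfty.out)).eq u v

end Calculus

/-- `G` is the coordinate expression of a smooth Riemannian metric on the open set `Ω`. -/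
structure IsMetricOn (G : V → V →L[ℝ] V →L[ℝ] ℝ) (Ω : Set V) : Prop where
  isOpen : IsOpen Ω
  smooth : ContDiffOn ℝ ∞ G Ω
  symm : ∀ x ∈ Ω, ∀ v w, G x v w = G x w v
  pos : ∀ x ∈ Ω, ∀ v, v ≠ 0 → 0 < G x v v

variable {G H : V → V →L[ℝ] V →L[ℝ] ℝ} {Ω Ω' : Set V} {x : V}

namespace IsMetricOn

/-- Nondegeneracy of the metric. Vector identities are proved by pairing with an arbitrary vector,
which removes the inverse metric from the Christoffel symbols. -/
theorem ext_inner (hG : IsMetricOn G Ω) (hx : x ∈ Ω) {v w : V} (h : ∀ z, G x v z = G x w z) :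
    v = w := by
  by_contra hne
  have := hG.pos x hx _ (sub_ne_zero.2 hne)
  simp [h] at this

theorem differentiableAt (hG : IsMetricOn G Ω) (hx : x ∈ Ω) : DifferentiableAt ℝ G x :=
  differentiableAt_of_contDiffOn hG.isOpen hG.smooth hx

theorem fderiv_symm (hG : IsMetricOn G Ω) (hx : x ∈ Ω) (u v w : V) :
    fderiv ℝ G x u v w = fderiv ℝ G x u w v := by
  rw [← fderiv_apply_const₂ (hG.differentiableAt hx),
    ← fderiv_apply_const₂ (hG.differentiableAt hx)]
  congr 1
  apply Filter.EventuallyEq.fderiv_eq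
  filter_upwards [hG.isOpen.mem_nhds hx] with y hy using hG.symm y hy v w

end IsMetricOn

variable [FiniteDimensional ℝ V]

theorem isInvertible_of_pos {g : V →L[ℝ] V →L[ℝ] ℝ} (hg : ∀ v, v ≠ 0 → 0 < g v v) :
    g.IsInvertible := by
  have hinj : Function.Injective g := by
    rw [injective_iff_map_eq_zero]
    intro v hv
    by_contra h
    simpa [hv] using hg v h
  have hdim : Module.finrank ℝ V = Module.finrank ℝ (V →L[ℝ] ℝ) := by
    rw [← (LinearMap.toContinuousLinearMap (𝕜 := ℝ) (E := V) (F' := ℝ)).finrank_eq]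
    exact (Subspace.dual_finrank_eq (K := ℝ) (V := V)).symm
  exact ⟨(LinearEquiv.ofInjectiveOfFinrankEq g.toLinearMap hinj hdim).toContinuousLinearEquiv, by
    ext; rfl⟩

namespace IsMetricOn

theorem isInvertible (hG : IsMetricOn G Ω) (hx : x ∈ Ω) : (G x).IsInvertible :=
  isInvertible_of_pos (hG.pos x hx)

theorem contDiffOn_inverse (hG : IsMetricOn G Ω) : ContDiffOn ℝ ∞ (fun x ↦ (G x).inverse) Ω :=
  fun x hx ↦ ((hG.isInvertible hx).contDiffAt_map_inverse.comp x
    (hG.smooth.contDiffAt (hG.isOpen.mem_nhds hx))).contDiffWithinAt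

theorem contDiffOn_christoffel (hG : IsMetricOn G Ω) : ContDiffOn ℝ ∞ (christoffel G) Ω := by
  have hD := contDiffOn_fderiv hG.isOpen hG.smooth
  have hDf : ContDiffOn ℝ ∞ (fun x ↦ (fderiv ℝ G x).flip) Ω :=
    (ContinuousLinearMap.flipₗᵢ ℝ V V (V →L[ℝ] ℝ)).contDiff.comp_contDiffOn hD
  have hinv := hG.contDiffOn_inverse
  unfold christoffel
  refine ContDiffOn.clm_comp
    ((ContinuousLinearMap.compL ℝ V (V →L[ℝ] ℝ) V).contDiff.comp_contDiffOn hinv) ?_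
  exact ((hD.add hDf).sub (contDiffOn_const.clm_comp hDf)).const_smul _

theorem differentiableAt_christoffel (hG : IsMetricOn G Ω) (hx : x ∈ Ω) :
    DifferentiableAt ℝ (christoffel G) x :=
  differentiableAt_of_contDiffOn hG.isOpen hG.contDiffOn_christoffel hx

/-- The connection is torsion-free, because the Koszul expression is symmetric in u and v. -/
theorem christoffel_symm (hG : IsMetricOn G Ω) (hx : x ∈ Ω) (u v : V) :
    christoffel G x u v = christoffel G x v u := by
  refine hG.ext_inner hx fun z ↦ ?_
  rw [christoffel_eq _ _ _ _ _ (hG.isInvertible hx), christoffel_eq _ _ _ _ _ (hG.isInvertible hx),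
    hG.fderiv_symm hx z u v]
  ring

/-- The Levi-Civita connection is compatible with the metric. -/
theorem fderiv_eq (hG : IsMetricOn G Ω) (hx : x ∈ Ω) (u v w : V) :
    fderiv ℝ G x u v w = G x (christoffel G x u v) w + G x v (christoffel G x u w) := by
  rw [hG.symm x hx v, christoffel_eq _ _ _ _ _ (hG.isInvertible hx),
    christoffel_eq _ _ _ _ _ (hG.isInvertible hx), hG.fderiv_symm hx u w v,
    hG.fderiv_symm hx v u w, hG.fderiv_symm hx w u v]
  ring

theorem fderiv_christoffel_symm (hG : IsMetricOn G Ω) (hx : x ∈ Ω) (u v w : V) :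
    fderiv ℝ (christoffel G) x u v w = fderiv ℝ (christoffel G) x u w v := by
  rw [← fderiv_apply_const₂ (hG.differentiableAt_christoffel hx),
    ← fderiv_apply_const₂ (hG.differentiableAt_christoffel hx)]
  congr 1
  apply Filter.EventuallyEq.fderiv_eq
  filter_upwards [hG.isOpen.mem_nhds hx] with y hy using hG.christoffel_symm hy v w

/-- The first Bianchi identity. -/
theorem bianchi (hG : IsMetricOn G Ω) (hx : x ∈ Ω) (u v w : V) :
    curvatureOp G x u v w + curvatureOp G x v w u + curvatureOp G x w u v = 0 := by
  simp only [curvatureOp_apply]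
  rw [hG.fderiv_christoffel_symm hx u w v, hG.fderiv_christoffel_symm hx v w u,
    hG.fderiv_christoffel_symm hx w v u, hG.christoffel_symm hx w v, hG.christoffel_symm hx w u,
    hG.christoffel_symm hx v u]
  abel

theorem contDiffOn_curvatureOp (hG : IsMetricOn G Ω) : ContDiffOn ℝ ∞ (curvatureOp G) Ω := by
  have hΓ := hG.contDiffOn_christoffel
  have hD := contDiffOn_fderiv hG.isOpen hΓ
  have hA : ContDiffOn ℝ ∞ (fun x ↦ fderiv ℝ (christoffel G) x +
      (ContinuousLinearMap.compL ℝ V V V).bilinearComp (christoffel G x) (christoffel G x)) Ω := by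
    refine hD.add ?_
    rw [contDiffOn_clm_apply]
    intro u
    rw [contDiffOn_clm_apply]
    intro v
    exact (hΓ.clm_apply contDiffOn_const).clm_comp (hΓ.clm_apply contDiffOn_const)
  exact hA.sub ((ContinuousLinearMap.flipₗᵢ ℝ V V (V →L[ℝ] V)).contDiff.comp_contDiffOn hA)

theorem contDiffOn_ricciLoc (hG : IsMetricOn G Ω) : ContDiffOn ℝ ∞ (ricciLoc G) Ω :=
  contDiffOn_const.clm_comp (contDiffOn_const.clm_comp
    ((ContinuousLinearMap.flipₗᵢ ℝ V V (V →L[ℝ] V)).contDiff.comp_contDiffOn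
      hG.contDiffOn_curvatureOp))

theorem contDiffOn_scalarLoc (hG : IsMetricOn G Ω) : ContDiffOn ℝ ∞ (scalarLoc G) Ω :=
  (traceCLM V).contDiff.comp_contDiffOn (hG.contDiffOn_inverse.clm_comp hG.contDiffOn_ricciLoc)

theorem contDiffOn_schoutenLoc (hG : IsMetricOn G Ω) : ContDiffOn ℝ ∞ (schoutenLoc G) Ω :=
  (hG.contDiffOn_ricciLoc.sub
    ((hG.contDiffOn_scalarLoc.div_const _).smul hG.smooth)).const_smul _

end IsMetricOn

end LocalGeometry

end ConfFlat

end

noncomputable section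

namespace ConfFlat

open Topology

/-! ### Naturality under local diffeomorphisms -/

section Pullback

variable {V : Type*} [NormedAddCommGroup V] [NormedSpace ℝ V]

/-- `G` is the pullback of the metric `H` by a local diffeomorphism `ψ : Ω → Ω'`. -/
structure IsPullbackOn (ψ : V → V) (G H : V → V →L[ℝ] V →L[ℝ] ℝ) (Ω Ω' : Set V) : Prop where
  isOpen : IsOpen Ω
  smooth : ContDiffOn ℝ ∞ ψ Ω
  mapsTo : Set.MapsTo ψ Ω Ω'
  bijective : ∀ x ∈ Ω, Function.Bijective (fderiv ℝ ψ x)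
  metric : IsMetricOn H Ω'
  eq : ∀ x ∈ Ω, G x = (H (ψ x)).bilinearComp (fderiv ℝ ψ x) (fderiv ℝ ψ x)

variable {G H : V → V →L[ℝ] V →L[ℝ] ℝ} {ψ : V → V} {Ω Ω' : Set V} {x : V}

theorem traceCLM_conj [FiniteDimensional ℝ V] (e : V ≃L[ℝ] V) {A B : V →L[ℝ] V}
    (hAB : ∀ v, e (A v) = B (e v)) :
    traceCLM V A = traceCLM V B := by
  have : (B : V →ₗ[ℝ] V) = e.toLinearEquiv.conj (A : V →ₗ[ℝ] V) := by
    ext v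
    simp [LinearEquiv.conj_apply, hAB]
  rw [traceCLM_apply, traceCLM_apply, this, LinearMap.trace_conj']

/-- Pulling back g and T by J replaces g⁻¹T by its conjugate J⁻¹(g⁻¹T)J, which has the same trace.
-/
theorem metricTrace_bilinearComp [FiniteDimensional ℝ V] {g T : V →L[ℝ] V →L[ℝ] ℝ}
    (hg : g.IsInvertible)
    {J : V →L[ℝ] V} (hJ : J.IsInvertible) :
    metricTrace (g.bilinearComp J J) (T.bilinearComp J J) = metricTrace g T := by
  obtain ⟨e, rfl⟩ := hJ
  have hg' := hg
  obtain ⟨γ, rfl⟩ := hg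
  have hinv : ((γ : V →L[ℝ] V →L[ℝ] ℝ).bilinearComp (e : V →L[ℝ] V)
      (e : V →L[ℝ] V)).IsInvertible := by
    refine ⟨(e.trans γ).trans (e.symm.arrowCongr (.refl ℝ ℝ)), ?_⟩
    ext u v
    simp
  refine traceCLM_conj e fun v ↦ ?_
  obtain ⟨δ, hδ⟩ := hinv
  rw [← hδ]
  simp only [ContinuousLinearMap.inverse_equiv, ContinuousLinearMap.comp_apply,
    ContinuousLinearEquiv.coe_coe]
  apply γ.injective
  rw [γ.apply_symm_apply]
  ext z
  obtain ⟨z, rfl⟩ := e.surjective z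
  have h1 : ∀ a b, γ (e a) (e b) = δ a b := fun a b ↦ by
    have := congrArg (fun t : V →L[ℝ] V →L[ℝ] ℝ ↦ t a b) hδ
    simpa using this.symm
  rw [h1, δ.apply_symm_apply]
  simp

namespace IsPullbackOn

theorem eq_apply (h : IsPullbackOn ψ G H Ω Ω') (hx : x ∈ Ω) (u v : V) :
    G x u v = H (ψ x) (fderiv ℝ ψ x u) (fderiv ℝ ψ x v) := by simp [h.eq x hx]

theorem isMetricOn (h : IsPullbackOn ψ G H Ω Ω') : IsMetricOn G Ω where
  isOpen := h.isOpen
  smooth := by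
    have hH : ContDiffOn ℝ ∞ (fun y ↦ H (ψ y)) Ω := h.metric.smooth.comp h.smooth h.mapsTo
    have hψ := contDiffOn_fderiv h.isOpen h.smooth
    have hc : ContDiffOn ℝ ∞ (fun y ↦ (H (ψ y)).bilinearComp (fderiv ℝ ψ y) (fderiv ℝ ψ y)) Ω := by
      have h1 : ContDiffOn ℝ ∞ (fun y ↦ ((H (ψ y)).comp (fderiv ℝ ψ y)).flip) Ω :=
        (ContinuousLinearMap.flipₗᵢ ℝ V V ℝ).contDiff.comp_contDiffOn (hH.clm_comp hψ)
      exact (ContinuousLinearMap.flipₗᵢ ℝ V V ℝ).contDiff.comp_contDiffOn (h1.clm_comp hψ)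
    exact hc.congr h.eq
  symm := fun x hx v w ↦ by
    rw [h.eq_apply hx, h.eq_apply hx, h.metric.symm _ (h.mapsTo hx)]
  pos := fun x hx v hv ↦ by
    rw [h.eq_apply hx]
    refine h.metric.pos _ (h.mapsTo hx) _ fun h0 ↦ hv ?_
    exact (h.bijective x hx).1 (by simp [h0])

theorem differentiableAt (h : IsPullbackOn ψ G H Ω Ω') (hx : x ∈ Ω) : DifferentiableAt ℝ ψ x :=
  differentiableAt_of_contDiffOn h.isOpen h.smooth hx

theorem differentiableAt_fderiv (h : IsPullbackOn ψ G H Ω Ω') (hx : x ∈ Ω) :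
    DifferentiableAt ℝ (fderiv ℝ ψ) x :=
  differentiableAt_of_contDiffOn h.isOpen (contDiffOn_fderiv h.isOpen h.smooth) hx

theorem fderiv_comp_apply {E : Type*} [NormedAddCommGroup E] [NormedSpace ℝ E]
    (h : IsPullbackOn ψ G H Ω Ω') (hx : x ∈ Ω) {f : V → E} (hf : DifferentiableAt ℝ f (ψ x))
    (u : V) : fderiv ℝ (fun y ↦ f (ψ y)) x u = fderiv ℝ f (ψ x) (fderiv ℝ ψ x u) := by
  have := fderiv_comp x hf (h.differentiableAt hx)
  simp only [Function.comp_def] at this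
  rw [this]; rfl

theorem fderiv_metric (h : IsPullbackOn ψ G H Ω Ω') (hx : x ∈ Ω) (u v w : V) :
    fderiv ℝ G x u v w = fderiv ℝ H (ψ x) (fderiv ℝ ψ x u) (fderiv ℝ ψ x v) (fderiv ℝ ψ x w) +
      H (ψ x) (fderiv ℝ (fderiv ℝ ψ) x u v) (fderiv ℝ ψ x w) +
      H (ψ x) (fderiv ℝ ψ x v) (fderiv ℝ (fderiv ℝ ψ) x u w) := by
  have hJ := h.differentiableAt_fderiv hx
  have hH := h.metric.differentiableAt (h.mapsTo hx)
  rw [← fderiv_apply_const₂ (h.isMetricOn.differentiableAt hx)]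
  have he : (fun y ↦ G y v w) =ᶠ[𝓝 x]
      fun y ↦ H (ψ y) (fderiv ℝ ψ y v) (fderiv ℝ ψ y w) := by
    filter_upwards [h.isOpen.mem_nhds hx] with y hy using h.eq_apply hy v w
  have hHψ : DifferentiableAt ℝ (fun y ↦ H (ψ y)) x := hH.comp x (h.differentiableAt hx)
  rw [he.fderiv_eq, fderiv_bilin_apply hHψ (hJ.clm_apply (differentiableAt_const v))
    (hJ.clm_apply (differentiableAt_const w)), h.fderiv_comp_apply hx hH,
    fderiv_apply_const hJ, fderiv_apply_const hJ]

variable [FiniteDimensional ℝ V]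

/-- The transformation rule of the Christoffel symbols. -/
theorem fderiv_christoffel_apply (h : IsPullbackOn ψ G H Ω Ω') (hx : x ∈ Ω) (u v : V) :
    fderiv ℝ ψ x (christoffel G x u v) = fderiv ℝ (fderiv ℝ ψ) x u v +
      christoffel H (ψ x) (fderiv ℝ ψ x u) (fderiv ℝ ψ x v) := by
  refine h.metric.ext_inner (h.mapsTo hx) fun z ↦ ?_
  obtain ⟨w, rfl⟩ := (h.bijective x hx).2 z
  rw [← h.eq_apply hx, christoffel_eq _ _ _ _ _ (h.isMetricOn.isInvertible hx), map_add,
    add_apply, christoffel_eq _ _ _ _ _ (h.metric.isInvertible (h.mapsTo hx))]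
  simp only [h.fderiv_metric hx]
  -- In the Koszul combination the second derivatives of ψ cancel by symmetry, except for D²ψ(u, v).
  have hs := second_fderiv_symm h.isOpen h.smooth hx
  have hH := h.metric.symm _ (h.mapsTo hx)
  rw [hs v u, hs w u, hs w v, hH (fderiv ℝ (fderiv ℝ ψ) x u w),
    hH (fderiv ℝ ψ x u) (fderiv ℝ (fderiv ℝ ψ) x v w)]
  ring

/-- The curvature is natural. -/
theorem fderiv_curvatureOp_apply (h : IsPullbackOn ψ G H Ω Ω') (hx : x ∈ Ω) (u v w : V) :
    fderiv ℝ ψ x (curvatureOp G x u v w) =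
      curvatureOp H (ψ x) (fderiv ℝ ψ x u) (fderiv ℝ ψ x v) (fderiv ℝ ψ x w) := by
  have hJ := h.differentiableAt_fderiv hx
  have hJ2 := differentiableAt_of_contDiffOn h.isOpen (contDiffOn_fderiv h.isOpen
    (contDiffOn_fderiv h.isOpen h.smooth)) hx
  have hΓ := h.isMetricOn.differentiableAt_christoffel hx
  have hΓ' := h.metric.differentiableAt_christoffel (h.mapsTo hx)
  have hΓψ : DifferentiableAt ℝ (fun y ↦ christoffel H (ψ y)) x :=
    hΓ'.comp x (h.differentiableAt hx)
  -- This is the derivative of the transformation rule of the Christoffel symbols in the direction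
  -- u.
  have key : ∀ u v w, fderiv ℝ ψ x (fderiv ℝ (christoffel G) x u v w) =
      fderiv ℝ (fderiv ℝ (fderiv ℝ ψ)) x u v w +
      fderiv ℝ (christoffel H) (ψ x) (fderiv ℝ ψ x u) (fderiv ℝ ψ x v) (fderiv ℝ ψ x w) +
      christoffel H (ψ x) (fderiv ℝ (fderiv ℝ ψ) x u v) (fderiv ℝ ψ x w) +
      christoffel H (ψ x) (fderiv ℝ ψ x v) (fderiv ℝ (fderiv ℝ ψ) x u w) -
      fderiv ℝ (fderiv ℝ ψ) x u (christoffel G x v w) := by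
    intro u v w
    have he : (fun y ↦ fderiv ℝ ψ y (christoffel G y v w)) =ᶠ[𝓝 x]
        (fun y ↦ fderiv ℝ (fderiv ℝ ψ) y v w) +
          fun y ↦ christoffel H (ψ y) (fderiv ℝ ψ y v) (fderiv ℝ ψ y w) := by
      filter_upwards [h.isOpen.mem_nhds hx] with y hy using h.fderiv_christoffel_apply hy v w
    have h1 := DFunLike.congr_fun (he.fderiv_eq (𝕜 := ℝ)) u
    have hv := hJ.clm_apply (differentiableAt_const v)
    have hw := hJ.clm_apply (differentiableAt_const w)
    rw [fderiv_clm_apply_apply hJ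
      ((hΓ.clm_apply (differentiableAt_const v)).clm_apply (differentiableAt_const w)),
      fderiv_add ((hJ2.clm_apply (differentiableAt_const v)).clm_apply (differentiableAt_const w))
        ((hΓψ.clm_apply hv).clm_apply hw), add_apply,
      fderiv_apply_const₂ hΓ, fderiv_apply_const₂ hJ2, fderiv_bilin_apply hΓψ hv hw,
      h.fderiv_comp_apply hx hΓ', fderiv_apply_const hJ, fderiv_apply_const hJ] at h1
    rw [eq_sub_iff_add_eq, add_comm, h1]
    abel
  -- Antisymmetrising in u and v removes D³ψ and the term with D²ψ(u, v). The other D²ψ terms cancel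
  -- against those produced by the quadratic part ΓΓ.
  have hs := second_fderiv_symm h.isOpen h.smooth hx
  have hs3 := second_fderiv_symm h.isOpen (contDiffOn_fderiv h.isOpen h.smooth) hx
  simp only [curvatureOp_apply, map_sub, map_add, key, h.fderiv_christoffel_apply hx]
  rw [hs3 v u, hs v u]
  abel

theorem isInvertible (h : IsPullbackOn ψ G H Ω Ω') (hx : x ∈ Ω) :
    (fderiv ℝ ψ x).IsInvertible :=
  ⟨(LinearEquiv.ofBijective (fderiv ℝ ψ x).toLinearMap
    (h.bijective x hx)).toContinuousLinearEquiv, by ext; rfl⟩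

theorem ricciLoc_eq (h : IsPullbackOn ψ G H Ω Ω') (hx : x ∈ Ω) :
    ricciLoc G x = (ricciLoc H (ψ x)).bilinearComp (fderiv ℝ ψ x) (fderiv ℝ ψ x) := by
  obtain ⟨e, he⟩ := h.isInvertible hx
  ext u v
  rw [ContinuousLinearMap.bilinearComp_apply, ricciLoc_apply, ricciLoc_apply]
  refine traceCLM_conj e fun z ↦ ?_
  have := h.fderiv_curvatureOp_apply hx z u v
  simpa [← he] using this

theorem scalarLoc_eq (h : IsPullbackOn ψ G H Ω Ω') (hx : x ∈ Ω) :
    scalarLoc G x = scalarLoc H (ψ x) := by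
  rw [scalarLoc, h.ricciLoc_eq hx, h.eq x hx, metricTrace_bilinearComp
    (h.metric.isInvertible (h.mapsTo hx)) (h.isInvertible hx), scalarLoc]

theorem schoutenLoc_eq (h : IsPullbackOn ψ G H Ω Ω') (hx : x ∈ Ω) :
    schoutenLoc G x = (schoutenLoc H (ψ x)).bilinearComp (fderiv ℝ ψ x) (fderiv ℝ ψ x) := by
  ext u v
  simp [schoutenLoc, h.ricciLoc_eq hx, h.scalarLoc_eq hx, h.eq_apply hx]

theorem hessian_eq (h : IsPullbackOn ψ G H Ω Ω') (hx : x ∈ Ω) {f : V → ℝ}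
    (hf : ContDiffOn ℝ ∞ f Ω') :
    hessian G (f ∘ ψ) x = (hessian H f (ψ x)).bilinearComp (fderiv ℝ ψ x) (fderiv ℝ ψ x) := by
  have hΩ' := h.metric.isOpen
  have hJ := h.differentiableAt_fderiv hx
  have hf' := differentiableAt_of_contDiffOn hΩ' (contDiffOn_fderiv hΩ' hf) (h.mapsTo hx)
  have hd : ∀ y ∈ Ω, ∀ v, fderiv ℝ (f ∘ ψ) y v = fderiv ℝ f (ψ y) (fderiv ℝ ψ y v) :=
    fun y hy v ↦ h.fderiv_comp_apply hy (differentiableAt_of_contDiffOn hΩ' hf (h.mapsTo hy)) v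
  have hfψ : DifferentiableAt ℝ (fderiv ℝ (f ∘ ψ)) x := differentiableAt_of_contDiffOn h.isOpen
    (contDiffOn_fderiv h.isOpen (hf.comp h.smooth h.mapsTo)) hx
  ext u v
  rw [ContinuousLinearMap.bilinearComp_apply, hessian_apply, hessian_apply, hd x hx,
    h.fderiv_christoffel_apply hx, ← fderiv_apply_const hfψ]
  have he : (fun y ↦ fderiv ℝ (f ∘ ψ) y v) =ᶠ[𝓝 x]
      fun y ↦ fderiv ℝ f (ψ y) (fderiv ℝ ψ y v) := by
    filter_upwards [h.isOpen.mem_nhds hx] with y hy using hd y hy v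
  rw [he.fderiv_eq, fderiv_clm_apply_apply (A := fun y ↦ fderiv ℝ f (ψ y))
    (hf'.comp x (h.differentiableAt hx)) (hJ.clm_apply (differentiableAt_const v)),
    h.fderiv_comp_apply hx hf', fderiv_apply_const hJ, map_add]
  ring

theorem osgoodStoweLoc_eq (h : IsPullbackOn ψ G H Ω Ω') (hx : x ∈ Ω) {f : V → ℝ}
    (hf : ContDiffOn ℝ ∞ f Ω') :
    osgoodStoweLoc G (f ∘ ψ) x =
      (osgoodStoweLoc H f (ψ x)).bilinearComp (fderiv ℝ ψ x) (fderiv ℝ ψ x) := by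
  have hd : ∀ v, fderiv ℝ (f ∘ ψ) x v = fderiv ℝ f (ψ x) (fderiv ℝ ψ x v) :=
    fun v ↦ h.fderiv_comp_apply hx
      (differentiableAt_of_contDiffOn h.metric.isOpen hf (h.mapsTo hx)) v
  have hgrad : fderiv ℝ ψ x ((G x).inverse (fderiv ℝ (f ∘ ψ) x)) =
      (H (ψ x)).inverse (fderiv ℝ f (ψ x)) := by
    refine h.metric.ext_inner (h.mapsTo hx) fun z ↦ ?_
    obtain ⟨w, rfl⟩ := (h.bijective x hx).2 z
    rw [← h.eq_apply hx]
    obtain ⟨e, he⟩ := h.isMetricOn.isInvertible hx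
    obtain ⟨e', he'⟩ := h.metric.isInvertible (h.mapsTo hx)
    rw [← he, ← he']
    simp [hd]
  have htr : metricTrace (G x) (hessian G (f ∘ ψ) x) =
      metricTrace (H (ψ x)) (hessian H f (ψ x)) := by
    rw [h.hessian_eq hx hf, h.eq x hx, metricTrace_bilinearComp
      (h.metric.isInvertible (h.mapsTo hx)) (h.isInvertible hx)]
  ext u v
  simp only [osgoodStoweLoc, ContinuousLinearMap.bilinearComp_apply, sub_apply, smul_apply,
    ContinuousLinearMap.smulRight_apply]
  rw [htr, h.hessian_eq hx hf, h.eq_apply hx, h.eq_apply hx, hgrad, hd, hd]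
  simp

/-- Differentiate the intertwining relation Dψ B = B' Dψ; the D²ψ terms that appear are absorbed by
the transformation rule of the Christoffel symbols. -/
theorem fderiv_covDerivEnd (h : IsPullbackOn ψ G H Ω Ω') (hx : x ∈ Ω) {B B' : V → V →L[ℝ] V}
    (hB : DifferentiableAt ℝ B x) (hB' : DifferentiableAt ℝ B' (ψ x))
    (hBB' : ∀ y ∈ Ω, ∀ v, fderiv ℝ ψ y (B y v) = B' (ψ y) (fderiv ℝ ψ y v)) (u v : V) :
    fderiv ℝ ψ x (covDerivEnd G B x u v) =
      covDerivEnd H B' (ψ x) (fderiv ℝ ψ x u) (fderiv ℝ ψ x v) := by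
  have hJ := h.differentiableAt_fderiv hx
  have he : (fun y ↦ fderiv ℝ ψ y (B y v)) =ᶠ[𝓝 x] fun y ↦ B' (ψ y) (fderiv ℝ ψ y v) := by
    filter_upwards [h.isOpen.mem_nhds hx] with y hy using hBB' y hy v
  have h1 := DFunLike.congr_fun (he.fderiv_eq (𝕜 := ℝ)) u
  rw [fderiv_clm_apply_apply hJ (hB.clm_apply (differentiableAt_const v)),
    fderiv_clm_apply_apply (A := fun y ↦ B' (ψ y)) (hB'.comp x (h.differentiableAt hx))
      (hJ.clm_apply (differentiableAt_const v)), h.fderiv_comp_apply hx hB',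
    fderiv_apply_const hJ, fderiv_apply_const hB] at h1
  have h2 := eq_sub_of_add_eq' h1
  simp only [covDerivEnd, map_sub, map_add, h.fderiv_christoffel_apply hx, hBB' x hx, h2]
  abel

end IsPullbackOn

end Pullback

end ConfFlat

end

noncomputable section

namespace ConfFlat

open Topology

section Trace

variable {V : Type*} [NormedAddCommGroup V] [NormedSpace ℝ V] [FiniteDimensional ℝ V]

theorem traceCLM_smulRight (f : V →L[ℝ] ℝ) (v : V) : traceCLM V (f.smulRight v) = f v := by
  rw [traceCLM_apply]
  exact LinearMap.trace_smulRight _ _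

theorem traceCLM_id : traceCLM V (ContinuousLinearMap.id ℝ V) = Module.finrank ℝ V := by
  rw [traceCLM_apply]
  exact LinearMap.trace_id ℝ V

theorem metricTrace_comp {g : V →L[ℝ] V →L[ℝ] ℝ} (hg : g.IsInvertible) (τ : V →L[ℝ] V) :
    metricTrace g (g ∘L τ) = traceCLM V τ := by
  obtain ⟨e, rfl⟩ := hg
  have : (e : V →L[ℝ] V →L[ℝ] ℝ).inverse ∘L (e : V →L[ℝ] V →L[ℝ] ℝ) ∘L τ = τ := by
    ext v
    simp
  rw [metricTrace, this]

end Trace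

/-! ### Curvature of e^{2u} ḡ in Euclidean coordinates -/

section ConformallyEuclidean

open InnerProductSpace

local notation "⟪" x ", " y "⟫" => inner ℝ x y

variable {V : Type*} [NormedAddCommGroup V] [InnerProductSpace ℝ V]

/-- The Euclidean metric. -/
def euclid (V : Type*) [NormedAddCommGroup V] [InnerProductSpace ℝ V] : V →L[ℝ] V →L[ℝ] ℝ :=
  innerSL ℝ

@[simp]
theorem euclid_apply (v w : V) : euclid V v w = ⟪v, w⟫ := rfl

theorem inner_self_pos_of_ne_zero {v : V} (hv : v ≠ 0) : 0 < ⟪v, v⟫ := by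
  rw [real_inner_self_eq_norm_sq]
  positivity

/-- `H = e^{2u} ḡ` on the open set `Ω`, with `u` smooth. -/
structure IsConfEuclidOn (H : V → V →L[ℝ] V →L[ℝ] ℝ) (u : V → ℝ) (Ω : Set V) : Prop where
  isOpen : IsOpen Ω
  smooth : ContDiffOn ℝ ∞ u Ω
  eq : ∀ x ∈ Ω, H x = Real.exp (2 * u x) • euclid V

theorem isMetricOn_euclid {Ω : Set V} (hΩ : IsOpen Ω) : IsMetricOn (fun _ ↦ euclid V) Ω where
  isOpen := hΩ
  smooth := contDiffOn_const
  symm := fun _ _ v w ↦ real_inner_comm w v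
  pos := fun _ _ _ hv ↦ inner_self_pos_of_ne_zero hv

variable {u : V → ℝ} {Ω : Set V} {H : V → V →L[ℝ] V →L[ℝ] ℝ} {x : V}

theorem IsConfEuclidOn.eq_apply (h : IsConfEuclidOn H u Ω) (hx : x ∈ Ω) (v w : V) :
    H x v w = Real.exp (2 * u x) * ⟪v, w⟫ := by simp [h.eq x hx]

theorem IsConfEuclidOn.isMetricOn (h : IsConfEuclidOn H u Ω) : IsMetricOn H Ω where
  isOpen := h.isOpen
  smooth := by
    have : ContDiffOn ℝ ∞ (fun x ↦ Real.exp (2 * u x) • euclid V) Ω :=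
      (contDiffOn_const.mul h.smooth).exp.smul contDiffOn_const
    exact this.congr h.eq
  symm := fun x hx v w ↦ by rw [h.eq_apply hx, h.eq_apply hx, real_inner_comm]
  pos := fun x hx v hv ↦ by
    rw [h.eq_apply hx]
    have := inner_self_pos_of_ne_zero hv
    positivity

theorem IsConfEuclidOn.eq_comp (h : IsConfEuclidOn H u Ω) (hx : x ∈ Ω) (τ : V →L[ℝ] V) :
    euclid V ∘L τ = H x ∘L ((Real.exp (2 * u x))⁻¹ • τ) := by
  ext v w
  simp [h.eq_apply hx]

variable [FiniteDimensional ℝ V]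

theorem euclid_isInvertible : (euclid V).IsInvertible :=
  isInvertible_of_pos fun _ hv ↦ inner_self_pos_of_ne_zero hv

/-- `τ = ∇²u - du ⊗ ∇u + |∇u|² / 2`, with respect to the Euclidean metric. -/
def confEnd (u : V → ℝ) (x : V) : V →L[ℝ] V :=
  fderiv ℝ (gradient u) x - (euclid V (gradient u x)).smulRight (gradient u x) +
    ((1 / 2 : ℝ) * ⟪gradient u x, gradient u x⟫) • ContinuousLinearMap.id ℝ V

theorem confEnd_apply (u : V → ℝ) (x v : V) : confEnd u x v = fderiv ℝ (gradient u) x v -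
    ⟪gradient u x, v⟫ • gradient u x + ((1 / 2 : ℝ) * ⟪gradient u x, gradient u x⟫) • v := by
  simp [confEnd]

theorem inner_gradient (u : V → ℝ) (x v : V) : ⟪gradient u x, v⟫ = fderiv ℝ u x v := by
  rw [gradient, toDual_symm_apply]

theorem contDiffOn_gradient (hΩ : IsOpen Ω) (hu : ContDiffOn ℝ ∞ u Ω) :
    ContDiffOn ℝ ∞ (gradient u) Ω :=
  (toDual ℝ V).symm.contDiff.comp_contDiffOn (contDiffOn_fderiv hΩ hu)

theorem inner_fderiv_gradient (hΩ : IsOpen Ω) (hu : ContDiffOn ℝ ∞ u Ω) (hx : x ∈ Ω) (v w : V) :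
    ⟪fderiv ℝ (gradient u) x v, w⟫ = fderiv ℝ (fderiv ℝ u) x v w := by
  have h1 := differentiableAt_of_contDiffOn hΩ (contDiffOn_gradient hΩ hu) hx
  have h2 := differentiableAt_of_contDiffOn hΩ (contDiffOn_fderiv hΩ hu) hx
  rw [← fderiv_apply_const h2, ← funext fun y ↦ inner_gradient u y w,
    fderiv_inner_apply ℝ h1 (differentiableAt_const w)]
  simp

theorem inner_fderiv_gradient_symm (hΩ : IsOpen Ω) (hu : ContDiffOn ℝ ∞ u Ω) (hx : x ∈ Ω)
    (v w : V) : ⟪fderiv ℝ (gradient u) x v, w⟫ = ⟪fderiv ℝ (gradient u) x w, v⟫ := by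
  rw [inner_fderiv_gradient hΩ hu hx, inner_fderiv_gradient hΩ hu hx, second_fderiv_symm hΩ hu hx]

namespace IsConfEuclidOn

theorem fderiv_exp (h : IsConfEuclidOn H u Ω) (hx : x ∈ Ω) (c : ℝ) (a : V) :
    fderiv ℝ (fun y ↦ Real.exp (c * u y)) x a =
      c * ⟪gradient u x, a⟫ * Real.exp (c * u x) := by
  have hu := differentiableAt_of_contDiffOn h.isOpen h.smooth hx
  rw [_root_.fderiv_exp (hu.const_mul c), fderiv_const_mul hu, inner_gradient]
  simp
  ring

theorem christoffel_eq (h : IsConfEuclidOn H u Ω) (hx : x ∈ Ω) (a b : V) :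
    christoffel H x a b =
      ⟪gradient u x, a⟫ • b + ⟪gradient u x, b⟫ • a - ⟪a, b⟫ • gradient u x := by
  have hD : ∀ a b c, fderiv ℝ H x a b c =
      2 * ⟪gradient u x, a⟫ * Real.exp (2 * u x) * ⟪b, c⟫ := by
    intro a b c
    rw [← fderiv_apply_const₂ (h.isMetricOn.differentiableAt hx), ← h.fderiv_exp hx]
    have he : (fun y ↦ H y b c) =ᶠ[𝓝 x] fun y ↦ Real.exp (2 * u y) * ⟪b, c⟫ := by
      filter_upwards [h.isOpen.mem_nhds hx] with y hy using h.eq_apply hy b c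
    have hu := differentiableAt_of_contDiffOn h.isOpen h.smooth hx
    rw [he.fderiv_eq, fderiv_mul_const (hu.const_mul 2).exp]
    simp [mul_comm]
  refine h.isMetricOn.ext_inner hx fun z ↦ ?_
  rw [ConfFlat.christoffel_eq _ _ _ _ _ (h.isMetricOn.isInvertible hx), hD, hD, hD, h.eq_apply hx]
  simp only [inner_sub_left, inner_add_left, real_inner_smul_left]
  rw [real_inner_comm]
  ring

theorem differentiableAt_gradient (h : IsConfEuclidOn H u Ω) (hx : x ∈ Ω) :
    DifferentiableAt ℝ (gradient u) x :=
  differentiableAt_of_contDiffOn h.isOpen (contDiffOn_gradient h.isOpen h.smooth) hx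

/-- The Christoffel symbols are linear in ∇u. Their derivative supplies the Hessian part of τ, and
the quadratic part ΓΓ supplies -du ⊗ ∇u + |∇u|²/2. The Weyl part is absent. -/
theorem curvatureOp_eq (h : IsConfEuclidOn H u Ω) (hx : x ∈ Ω) (a b c : V) :
    curvatureOp H x a b c = -(⟪confEnd u x b, c⟫ • a - ⟪confEnd u x a, c⟫ • b +
      ⟪b, c⟫ • confEnd u x a - ⟪a, c⟫ • confEnd u x b) := by
  have hw := h.differentiableAt_gradient hx
  have hD : ∀ a b c, fderiv ℝ (christoffel H) x a b c =
      ⟪fderiv ℝ (gradient u) x a, b⟫ • c + ⟪fderiv ℝ (gradient u) x a, c⟫ • b -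
        ⟪b, c⟫ • fderiv ℝ (gradient u) x a := by
    intro a b c
    rw [← fderiv_apply_const₂ (h.isMetricOn.differentiableAt_christoffel hx)]
    have he : (fun y ↦ christoffel H y b c) =ᶠ[𝓝 x] fun y ↦
        ⟪gradient u y, b⟫ • c + ⟪gradient u y, c⟫ • b - ⟪b, c⟫ • gradient u y := by
      filter_upwards [h.isOpen.mem_nhds hx] with y hy using h.christoffel_eq hy b c
    have hi : ∀ b : V, HasFDerivAt (fun y ↦ ⟪gradient u y, b⟫)
        ((euclid V b) ∘L fderiv ℝ (gradient u) x) x := fun b ↦ by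
      refine (hw.hasFDerivAt.inner ℝ (hasFDerivAt_const b x)).congr_fderiv ?_
      ext v
      simp [real_inner_comm]
    have hd : HasFDerivAt (fun y ↦ ⟪gradient u y, b⟫ • c + ⟪gradient u y, c⟫ • b -
        ⟪b, c⟫ • gradient u y) _ x := (((hi b).smul_const c).add ((hi c).smul_const b)).sub
      (hw.hasFDerivAt.const_smul ⟪b, c⟫)
    rw [he.fderiv_eq, hd.fderiv]
    simp [real_inner_comm]
  have hs := inner_fderiv_gradient_symm h.isOpen h.smooth hx
  simp only [curvatureOp_apply, hD, h.christoffel_eq hx, confEnd_apply, inner_sub_left,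
    inner_add_left, real_inner_smul_left, inner_sub_right, inner_add_right, real_inner_smul_right]
  rw [hs b a, real_inner_comm (gradient u x) a, real_inner_comm (gradient u x) b,
    real_inner_comm b a]
  module

theorem ricciLoc_eq (h : IsConfEuclidOn H u Ω) (hx : x ∈ Ω) :
    ricciLoc H x = euclid V ∘L (-(((Module.finrank ℝ V : ℝ) - 2) • confEnd u x +
      traceCLM V (confEnd u x) • ContinuousLinearMap.id ℝ V)) := by
  ext b c
  have : ((curvatureOp H x).flip b).flip c = -(⟪confEnd u x b, c⟫ • ContinuousLinearMap.id ℝ V -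
      (euclid V c ∘L confEnd u x).smulRight b + ⟪b, c⟫ • confEnd u x -
        (euclid V c).smulRight (confEnd u x b)) := by
    ext a
    simp [h.curvatureOp_eq hx, real_inner_comm]
  rw [ricciLoc_apply, this]
  simp only [map_neg, map_sub, map_add, map_smul, traceCLM_smulRight, traceCLM_id]
  simp [real_inner_comm]
  ring

theorem scalarLoc_eq (h : IsConfEuclidOn H u Ω) (hx : x ∈ Ω) :
    scalarLoc H x = (Real.exp (2 * u x))⁻¹ *
      (-(2 * (Module.finrank ℝ V - 1) * traceCLM V (confEnd u x))) := by
  rw [scalarLoc, h.ricciLoc_eq hx, h.eq_comp hx, metricTrace_comp (h.isMetricOn.isInvertible hx)]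
  simp only [map_neg, map_add, map_smul, traceCLM_id, smul_eq_mul]
  ring

/-- The trace term in Ric = -((n-2) τ♭ + (tr τ) ḡ) is removed by S g = -2(n-1)(tr τ) ḡ. Dividing by
n - 2, which needs n ≠ 2, leaves -τ♭. -/
theorem schoutenLoc_eq (h : IsConfEuclidOn H u Ω) (hx : x ∈ Ω) (hn : 3 ≤ Module.finrank ℝ V) :
    schoutenLoc H x = -(euclid V ∘L confEnd u x) := by
  have hn' : (3 : ℝ) ≤ Module.finrank ℝ V := by exact_mod_cast hn
  have h1 : (Module.finrank ℝ V : ℝ) - 1 ≠ 0 := by linarith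
  have h2 : (Module.finrank ℝ V : ℝ) - 2 ≠ 0 := by linarith
  ext b c
  simp only [schoutenLoc, h.ricciLoc_eq hx, h.scalarLoc_eq hx, smul_apply, sub_apply,
    h.eq_apply hx, ContinuousLinearMap.comp_apply, euclid_apply, neg_apply, add_apply,
    inner_neg_left, inner_add_left, real_inner_smul_left, ContinuousLinearMap.id_apply, smul_eq_mul]
  field_simp
  ring

/-- The endomorphism τ differs from ∇²u - du ⊗ ∇u by a multiple of the identity, so both have the
same trace-free part. -/
theorem osgoodStoweLoc_euclid (hΩ : IsOpen Ω) (hu : ContDiffOn ℝ ∞ u Ω) (hx : x ∈ Ω)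
    (hn : 0 < Module.finrank ℝ V) :
    osgoodStoweLoc (fun _ ↦ euclid V) u x = euclid V ∘L (confEnd u x -
      ((1 / Module.finrank ℝ V : ℝ) * traceCLM V (confEnd u x)) • ContinuousLinearMap.id ℝ V) := by
  have hΓ : christoffel (fun _ ↦ euclid V) x = 0 := by
    ext a b
    refine (isMetricOn_euclid hΩ).ext_inner hx fun z ↦ ?_
    refine (ConfFlat.christoffel_eq (fun _ ↦ euclid V) x a b z euclid_isInvertible).trans ?_
    simp
  have hH : hessian (fun _ ↦ euclid V) u x = euclid V ∘L fderiv ℝ (gradient u) x := by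
    ext a b
    simp [hessian_apply, hΓ, inner_fderiv_gradient hΩ hu hx]
  have hg : (euclid V).inverse (fderiv ℝ u x) = gradient u x := by
    obtain ⟨e, he⟩ := euclid_isInvertible (V := V)
    rw [← he, ContinuousLinearMap.inverse_equiv]
    have : fderiv ℝ u x = e (gradient u x) := by
      ext v
      have := DFunLike.congr_fun (DFunLike.congr_fun he (gradient u x)) v
      simp only [ContinuousLinearEquiv.coe_coe] at this
      rw [this, euclid_apply, inner_gradient]
    rw [this]; simp
  have htr : traceCLM V (fderiv ℝ (gradient u) x) = traceCLM V (confEnd u x) +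
      ⟪gradient u x, gradient u x⟫ -
      Module.finrank ℝ V * ((1 / 2 : ℝ) * ⟪gradient u x, gradient u x⟫) := by
    simp only [confEnd, map_add, map_sub, map_smul, traceCLM_smulRight, traceCLM_id, euclid_apply,
      smul_eq_mul]
    ring
  have hn' : (Module.finrank ℝ V : ℝ) ≠ 0 := by positivity
  ext a b
  simp only [osgoodStoweLoc, hH, hg, metricTrace_comp euclid_isInvertible, htr, sub_apply,
    smul_apply, ContinuousLinearMap.comp_apply, euclid_apply, ContinuousLinearMap.smulRight_apply,
    ← inner_gradient, confEnd_apply, inner_sub_left, inner_add_left, real_inner_smul_left,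
    ContinuousLinearMap.id_apply, smul_eq_mul]
  field_simp
  ring

/-- The relation between the Osgood-Stowe and Schouten tensors in conformal coordinates. -/
theorem two_smul_osgoodStoweLoc_sub (h : IsConfEuclidOn H u Ω) (hx : x ∈ Ω)
    (hn : 3 ≤ Module.finrank ℝ V) :
    (2 : ℝ) • osgoodStoweLoc (fun _ ↦ euclid V) u x -
      (scalarLoc H x / (Module.finrank ℝ V * ((Module.finrank ℝ V : ℝ) - 1))) • H x =
      (-2 : ℝ) • schoutenLoc H x := by
  have hn' : (3 : ℝ) ≤ Module.finrank ℝ V := by exact_mod_cast hn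
  have h1 : (Module.finrank ℝ V : ℝ) - 1 ≠ 0 := by linarith
  have h2 : (Module.finrank ℝ V : ℝ) ≠ 0 := by linarith
  -- The scalar term equals -(2/n)(tr τ) ḡ; subtracting it restores the trace removed from 2 OS and
  -- gives 2τ♭ = -2P.
  rw [osgoodStoweLoc_euclid h.isOpen h.smooth hx (by omega), h.schoutenLoc_eq hx hn]
  ext a b
  simp only [h.scalarLoc_eq hx, smul_apply, sub_apply, h.eq_apply hx,
    ContinuousLinearMap.comp_apply, euclid_apply, neg_apply,
    inner_sub_left, real_inner_smul_left, ContinuousLinearMap.id_apply, smul_eq_mul]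
  field_simp
  ring

theorem gauss (h : IsConfEuclidOn H u Ω) (hx : x ∈ Ω) (hn : 3 ≤ Module.finrank ℝ V)
    (a b c d : V) : H x (curvatureOp H x a b c) d =
      kulkarniNomizu (fun v w ↦ H x v w) (fun v w ↦ schoutenLoc H x v w) a b c d := by
  simp only [kulkarniNomizu, h.eq_apply hx, h.curvatureOp_eq hx, h.schoutenLoc_eq hx hn,
    neg_apply, ContinuousLinearMap.comp_apply, euclid_apply, inner_neg_left, inner_sub_left,
    inner_add_left, real_inner_smul_left]
  ring

/-- Here B = 2e^{-2u} τ. Third derivatives of u enter only through D²(∇u)(a, b), which is symmetric.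
The remaining terms cancel after antisymmetrisation because the Hessian is self-adjoint. -/
theorem codazzi (h : IsConfEuclidOn H u Ω) (hx : x ∈ Ω) (hn : 3 ≤ Module.finrank ℝ V)
    {B : V → V →L[ℝ] V} (hBd : DifferentiableAt ℝ B x)
    (hB : ∀ y ∈ Ω, ∀ v w, H y (B y v) w = -2 * schoutenLoc H y v w) (a b : V) :
    covDerivEnd H B x a b = covDerivEnd H B x b a := by
  have hB' : ∀ y ∈ Ω, ∀ v, B y v = (2 * Real.exp (-2 * u y)) • confEnd u y v := by
    intro y hy v
    refine h.isMetricOn.ext_inner hy fun z ↦ ?_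
    have he : Real.exp (2 * u y) * Real.exp (-2 * u y) = 1 := by
      rw [← Real.exp_add]; simp
    rw [hB y hy, h.schoutenLoc_eq hy hn, h.eq_apply hy, real_inner_smul_left]
    simp only [neg_apply, ContinuousLinearMap.comp_apply, euclid_apply]
    linear_combination (-2 * ⟪confEnd u y v, z⟫) * he
  have hw := h.differentiableAt_gradient hx
  have hgc := contDiffOn_gradient h.isOpen h.smooth
  have hA := differentiableAt_of_contDiffOn h.isOpen (contDiffOn_fderiv h.isOpen hgc) hx
  have hs := inner_fderiv_gradient_symm h.isOpen h.smooth hx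
  have hs3 := second_fderiv_symm h.isOpen hgc hx
  have hu := differentiableAt_of_contDiffOn h.isOpen h.smooth hx
  have hD : ∀ a b, fderiv ℝ B x a b = (2 * Real.exp (-2 * u x)) •
      (fderiv ℝ (fderiv ℝ (gradient u)) x a b -
        ⟪fderiv ℝ (gradient u) x a, b⟫ • gradient u x -
        ⟪gradient u x, b⟫ • fderiv ℝ (gradient u) x a +
        ⟪fderiv ℝ (gradient u) x a, gradient u x⟫ • b -
        (2 * ⟪gradient u x, a⟫) • confEnd u x b) := by
    intro a b
    rw [← fderiv_apply_const hBd]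
    have he : (fun y ↦ B y b) =ᶠ[𝓝 x] fun y ↦ (2 * Real.exp (-2 * u y)) •
        (fderiv ℝ (gradient u) y b - ⟪gradient u y, b⟫ • gradient u y +
          ((1 / 2 : ℝ) * ⟪gradient u y, gradient u y⟫) • b) := by
      filter_upwards [h.isOpen.mem_nhds hx] with y hy
      rw [hB' y hy, confEnd_apply]
    have hi : HasFDerivAt (fun y ↦ ⟪gradient u y, b⟫)
        ((euclid V b) ∘L fderiv ℝ (gradient u) x) x := by
      refine (hw.hasFDerivAt.inner ℝ (hasFDerivAt_const b x)).congr_fderiv ?_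
      ext v
      simp [real_inner_comm]
    have hii : HasFDerivAt (fun y ↦ (1 / 2 : ℝ) * ⟪gradient u y, gradient u y⟫)
        ((euclid V (gradient u x)) ∘L fderiv ℝ (gradient u) x) x := by
      refine ((hw.hasFDerivAt.inner ℝ hw.hasFDerivAt).const_mul (1 / 2 : ℝ)).congr_fderiv ?_
      ext v
      simp
      ring
    have hAb : HasFDerivAt (fun y ↦ fderiv ℝ (gradient u) y b)
        ((fderiv ℝ (fderiv ℝ (gradient u)) x).flip b) x := by
      refine (hA.hasFDerivAt.clm_apply (hasFDerivAt_const b x)).congr_fderiv ?_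
      ext v
      simp
    have hexp : HasFDerivAt (fun y ↦ 2 * Real.exp (-2 * u y))
        ((2 : ℝ) • fderiv ℝ (fun y ↦ Real.exp (-2 * u y)) x) x :=
      (hu.const_mul (-2)).exp.hasFDerivAt.const_mul 2
    have hd : HasFDerivAt (fun y ↦ (2 * Real.exp (-2 * u y)) •
        (fderiv ℝ (gradient u) y b - ⟪gradient u y, b⟫ • gradient u y +
          ((1 / 2 : ℝ) * ⟪gradient u y, gradient u y⟫) • b)) _ x :=
      hexp.smul ((hAb.sub (hi.smul hw.hasFDerivAt)).add (hii.smul_const b))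
    rw [he.fderiv_eq, hd.fderiv]
    simp only [add_apply, sub_apply, smul_apply, ContinuousLinearMap.smulRight_apply,
      ContinuousLinearMap.flip_apply, ContinuousLinearMap.comp_apply, euclid_apply,
      h.fderiv_exp hx, confEnd_apply, smul_eq_mul]
    rw [real_inner_comm (fderiv ℝ (gradient u) x a) b,
      real_inner_comm (fderiv ℝ (gradient u) x a) (gradient u x)]
    module
  simp only [covDerivEnd, hD, hB' x hx, h.christoffel_eq hx]
  have hi : ∀ a, ⟪gradient u x, fderiv ℝ (gradient u) x a⟫ =
      ⟪fderiv ℝ (gradient u) x a, gradient u x⟫ := fun a ↦ real_inner_comm _ _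
  have hi' : ∀ a b, ⟪a, fderiv ℝ (gradient u) x b⟫ =
      ⟪fderiv ℝ (gradient u) x b, a⟫ := fun a b ↦ real_inner_comm _ _
  simp only [confEnd_apply, inner_sub_right, inner_add_right, real_inner_smul_right, map_sub,
    map_add, map_smul]
  rw [hs3 b a, hi' a b, hi' b a, hs b a, hi a, hi b, real_inner_comm (gradient u x) a,
    real_inner_comm (gradient u x) b, real_inner_comm b a]
  module

end IsConfEuclidOn

end ConformallyEuclidean

end ConfFlat

end

noncomputable section

namespace ConfFlat

open Topology Metric

/-! ### The tractor connection and the developing map into the light cone -/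

section Tractor

variable {V : Type*} [NormedAddCommGroup V] [NormedSpace ℝ V]

/-- Local solutions of the Gauss-Codazzi equations `R = g ∧ g B`, `d^∇ B = 0` with `B`
self-adjoint. -/
structure IsGaussCodazziOn (G : V → V →L[ℝ] V →L[ℝ] ℝ) (B : V → V →L[ℝ] V) (Ω : Set V) :
    Prop where
  metric : IsMetricOn G Ω
  smooth : ContDiffOn ℝ ∞ B Ω
  symm : ∀ x ∈ Ω, ∀ v w, G x (B x v) w = G x (B x w) v
  gauss : ∀ x ∈ Ω, ∀ a b c, curvatureOp G x a b c =
    G x (B x b) c • a - G x (B x a) c • b + G x b c • B x a - G x a c • B x b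
  codazzi : ∀ x ∈ Ω, ∀ a b, covDerivEnd G B x a b = covDerivEnd G B x b a

variable {G : V → V →L[ℝ] V →L[ℝ] ℝ} {B : V → V →L[ℝ] V} {Ω : Set V} {x : V}

theorem IsGaussCodazziOn.differentiableAt (h : IsGaussCodazziOn G B Ω) (hx : x ∈ Ω) :
    DifferentiableAt ℝ B x :=
  differentiableAt_of_contDiffOn h.metric.isOpen h.smooth hx

variable [FiniteDimensional ℝ V]

/-- The connection form of the standard tractor bundle `ℝ × V × ℝ`, up to sign: a section
`(σ, m, ρ)` is parallel if its derivative in the direction `X` is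
`(g(X, m), -Γ(X, m) - σ B X - ρ X, g(B X, m))`. -/
def tractorForm (G : V → V →L[ℝ] V →L[ℝ] ℝ) (B : V → V →L[ℝ] V) (x : V) :
    V →L[ℝ] (ℝ × V × ℝ) →L[ℝ] (ℝ × V × ℝ) :=
  LinearMap.toContinuousLinearMap
    { toFun := fun X ↦ LinearMap.toContinuousLinearMap
        { toFun := fun s ↦ (G x X s.2.1, -christoffel G x X s.2.1 - s.1 • B x X - s.2.2 • X,
            G x (B x X) s.2.1)
          map_add' := fun s t ↦ by ext <;> simp; module
          map_smul' := fun c s ↦ by ext <;> simp; module }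
      map_add' := fun X Y ↦ by ext <;> simp <;> module
      map_smul' := fun c X ↦ by ext <;> simp }

theorem tractorForm_apply (G : V → V →L[ℝ] V →L[ℝ] ℝ) (B : V → V →L[ℝ] V) (x X : V)
    (s : ℝ × V × ℝ) : tractorForm G B x X s =
      (G x X s.2.1, -christoffel G x X s.2.1 - s.1 • B x X - s.2.2 • X, G x (B x X) s.2.1) := rfl

/-- The tractor metric. -/
def tractorMetric (g : V →L[ℝ] V →L[ℝ] ℝ) (s t : ℝ × V × ℝ) : ℝ :=
  s.1 * t.2.2 + s.2.2 * t.1 + g s.2.1 t.2.1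

namespace IsGaussCodazziOn

theorem contDiffOn_tractorForm (h : IsGaussCodazziOn G B Ω) :
    ContDiffOn ℝ ∞ (tractorForm G B) Ω := by
  have hG := h.metric.smooth
  have hΓ := h.metric.contDiffOn_christoffel
  have hB := h.smooth
  rw [contDiffOn_clm_apply]
  intro X
  rw [contDiffOn_clm_apply]
  intro s
  simp only [tractorForm_apply]
  refine ContDiffOn.prodMk ((hG.clm_apply contDiffOn_const).clm_apply contDiffOn_const)
    (ContDiffOn.prodMk ?_
      ((hG.clm_apply (hB.clm_apply contDiffOn_const)).clm_apply contDiffOn_const))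
  exact ((((hΓ.clm_apply contDiffOn_const).clm_apply contDiffOn_const).neg).sub
    (contDiffOn_const.smul (hB.clm_apply contDiffOn_const))).sub contDiffOn_const

theorem fderiv_tractorForm (h : IsGaussCodazziOn G B Ω) (hx : x ∈ Ω) (X Y : V) (s : ℝ × V × ℝ) :
    fderiv ℝ (tractorForm G B) x X Y s = (fderiv ℝ G x X Y s.2.1,
      -fderiv ℝ (christoffel G) x X Y s.2.1 - s.1 • fderiv ℝ B x X Y,
      fderiv ℝ G x X (B x Y) s.2.1 + G x (fderiv ℝ B x X Y) s.2.1) := by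
  have hG := h.metric.differentiableAt hx
  have hΓ := h.metric.differentiableAt_christoffel hx
  have hB := h.differentiableAt hx
  have hc : ∀ {E : Type _} [NormedAddCommGroup E] [NormedSpace ℝ E] (c : E),
    DifferentiableAt ℝ (fun _ : V ↦ c) x := fun c ↦ differentiableAt_const c
  rw [← fderiv_apply_const₂ (differentiableAt_of_contDiffOn h.metric.isOpen
    h.contDiffOn_tractorForm hx)]
  simp only [tractorForm_apply]
  have h1 : DifferentiableAt ℝ (fun y ↦ G y Y s.2.1) x := (hG.clm_apply (hc _)).clm_apply (hc _)
  have h2 : DifferentiableAt ℝ (fun y ↦ christoffel G y Y s.2.1) x :=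
    (hΓ.clm_apply (hc _)).clm_apply (hc _)
  have h3 : DifferentiableAt ℝ (fun y ↦ B y Y) x := hB.clm_apply (hc _)
  have h4 : DifferentiableAt ℝ (fun y ↦ G y (B y Y) s.2.1) x :=
    (hG.clm_apply h3).clm_apply (hc _)
  have h5 : HasFDerivAt (fun y ↦ -christoffel G y Y s.2.1 - s.1 • B y Y - s.2.2 • Y) _ x :=
    (h2.hasFDerivAt.neg.sub (h3.hasFDerivAt.const_smul s.1)).sub_const _
  rw [(h1.hasFDerivAt.prodMk (h5.prodMk h4.hasFDerivAt)).fderiv]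
  simp only [ContinuousLinearMap.prod_apply, sub_apply, neg_apply, smul_apply,
    fderiv_apply_const₂ hG, fderiv_apply_const₂ hΓ, fderiv_apply_const hB,
    fderiv_bilin_apply hG h3 (hc s.2.1)]
  simp

/-- Flatness splits into components. The ℝ-component σ uses self-adjointness of B and vanishing
torsion; the V-component is the Gauss equation plus σ times the Codazzi equation; the ℝ-component ρ
is the Codazzi equation paired with m, up to self-adjointness. -/
theorem tractorForm_flat (h : IsGaussCodazziOn G B Ω) (hx : x ∈ Ω) (X Y : V) (s : ℝ × V × ℝ) :
    fderiv ℝ (tractorForm G B) x X Y s + tractorForm G B x Y (tractorForm G B x X s) =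
    fderiv ℝ (tractorForm G B) x Y X s + tractorForm G B x X (tractorForm G B x Y s) := by
  obtain ⟨σ, m, ρ⟩ := s
  have hG := h.metric.symm x hx
  have hD := h.metric.fderiv_eq hx
  have hΓ := h.metric.christoffel_symm hx
  have hcod := h.codazzi x hx X Y
  have hgauss := h.gauss x hx X Y m
  rw [curvatureOp_apply] at hgauss
  simp only [covDerivEnd, hΓ Y X, sub_left_inj] at hcod
  simp only [h.fderiv_tractorForm hx, tractorForm_apply, Prod.mk_add_mk, Prod.mk.injEq]
  refine ⟨?_, ?_, ?_⟩
  · simp only [hD, map_sub, map_neg, map_smul, smul_eq_mul]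
    rw [hΓ Y X, hG Y (B x X), hG X (B x Y), h.symm x hx X Y, hG Y X]
    ring
  · simp only [map_sub, map_neg, map_smul]
    rw [hΓ Y X]
    linear_combination (norm := module) -hgauss - σ • hcod
  · have h1 := congrArg (fun v ↦ G x v m) hcod
    simp only [map_add, add_apply] at h1
    simp only [hD, map_sub, map_neg, map_smul, smul_eq_mul]
    rw [hG (B x X) (B x Y), h.symm x hx Y X]
    linear_combination h1

/-- Near every point there is a frame of parallel tractors, and it preserves the tractor
metric. -/
theorem exists_parallel_frame (h : IsGaussCodazziOn G B Ω) {x₀ : V} (hx₀ : x₀ ∈ Ω) :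
    ∃ r > 0, ball x₀ r ⊆ Ω ∧ ∃ Φ : V → (ℝ × V × ℝ) →L[ℝ] (ℝ × V × ℝ),
      Φ x₀ = ContinuousLinearMap.id ℝ _ ∧ ContDiffOn ℝ ∞ Φ (ball x₀ r) ∧
      (∀ x ∈ ball x₀ r, ∀ X e, fderiv ℝ Φ x X e = tractorForm G B x X (Φ x e)) ∧
      ∀ x ∈ ball x₀ r, ∀ e e', tractorMetric (G x) (Φ x e) (Φ x e') =
        tractorMetric (G x₀) e e' := by
  -- The whole frame is found at once: the unknown is endomorphism-valued, and the connection form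
  -- acts on it by left composition.
  let C := ContinuousLinearMap.compL ℝ (ℝ × V × ℝ) (ℝ × V × ℝ) (ℝ × V × ℝ)
  have hθ := h.contDiffOn_tractorForm
  have hθd := fun {x} (hx : x ∈ Ω) ↦ differentiableAt_of_contDiffOn h.metric.isOpen hθ hx
  have hfd : ∀ x ∈ Ω, ∀ X, fderiv ℝ (fun y ↦ C ∘L tractorForm G B y) x X =
      C ∘L fderiv ℝ (tractorForm G B) x X := by
    intro x hx X
    have hd : HasFDerivAt (fun y ↦ C ∘L tractorForm G B y) _ x :=
      (ContinuousLinearMap.compL ℝ V _ _ C).hasFDerivAt.comp x (hθd hx).hasFDerivAt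
    rw [hd.fderiv]
    rfl
  obtain ⟨r, hr, hsub, Φ, hΦ0, hΦs, hΦ⟩ := exists_solution_of_flat
    (θ := fun y ↦ C ∘L tractorForm G B y) h.metric.isOpen (contDiffOn_const.clm_comp hθ)
    (fun x hx X Y z ↦ by
      rw [hfd x hx, hfd x hx]
      refine ContinuousLinearMap.ext fun e ↦ ?_
      exact h.tractorForm_flat hx X Y (z e)) hx₀ (ContinuousLinearMap.id ℝ (ℝ × V × ℝ))
  have hΦ' : ∀ x ∈ ball x₀ r, ∀ X e, fderiv ℝ Φ x X e = tractorForm G B x X (Φ x e) := by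
    intro x hx X e
    rw [(hΦ x hx).fderiv]
    rfl
  refine ⟨r, hr, hsub, Φ, hΦ0, hΦs, hΦ', fun x hx e e' ↦ ?_⟩
  have hΦd : ∀ x ∈ ball x₀ r, DifferentiableAt ℝ Φ x := fun x hx ↦ (hΦ x hx).differentiableAt
  -- The pairing of two parallel tractors has zero derivative: metric compatibility cancels the
  -- Christoffel terms, and the terms with σ and ρ cancel in pairs.
  have hconst : ∀ x ∈ ball x₀ r, HasFDerivAt
      (fun y ↦ tractorMetric (G y) (Φ y e) (Φ y e')) (0 : V →L[ℝ] ℝ) x := by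
    intro x hx
    have hG := h.metric.differentiableAt (hsub hx)
    have hΦe : ∀ e, HasFDerivAt (fun y ↦ Φ y e) (fderiv ℝ (fun y ↦ Φ y e) x) x := fun e ↦
      ((hΦd x hx).clm_apply (differentiableAt_const e)).hasFDerivAt
    have p1 := fun e ↦ (hΦe e).fst
    have p2 := fun e ↦ (hΦe e).snd.fst
    have p3 := fun e ↦ (hΦe e).snd.snd
    have hgd : DifferentiableAt ℝ (fun y ↦ G y (Φ y e).2.1 (Φ y e').2.1) x :=
      (hG.clm_apply (p2 e).differentiableAt).clm_apply (p2 e').differentiableAt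
    have hd : HasFDerivAt (fun y ↦ (Φ y e).1 * (Φ y e').2.2 + (Φ y e).2.2 * (Φ y e').1 +
      G y (Φ y e).2.1 (Φ y e').2.1) _ x :=
      (((p1 e).mul (p3 e')).add ((p3 e).mul (p1 e'))).add hgd.hasFDerivAt
    refine hd.congr_fderiv ?_
    ext X
    have hX : ∀ e, fderiv ℝ (fun y ↦ Φ y e) x X = tractorForm G B x X (Φ x e) := fun e ↦ by
      rw [fderiv_apply_const (hΦd x hx), hΦ' x hx]
    simp only [add_apply, smul_apply, ContinuousLinearMap.comp_apply,
      ContinuousLinearMap.coe_fst', ContinuousLinearMap.coe_snd',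
      fderiv_bilin_apply hG (p2 e).differentiableAt (p2 e').differentiableAt, (p2 _).fderiv, hX,
      h.metric.fderiv_eq (hsub hx), tractorForm_apply, zero_apply, smul_eq_mul, map_sub,
      map_neg, map_smul, sub_apply, neg_apply]
    have hs := h.metric.symm x (hsub hx)
    rw [hs (Φ x e).2.1 (B x X), hs (Φ x e).2.1 X]
    ring
  have := (convex_ball x₀ r).is_const_of_fderivWithin_eq_zero (𝕜 := ℝ)
    (f := fun y ↦ tractorMetric (G y) (Φ y e) (Φ y e'))
    (fun y hy ↦ (hconst y hy).differentiableAt.differentiableWithinAt)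
    (fun y hy ↦ ((hconst y hy).hasFDerivWithinAt.fderivWithin
      (isOpen_ball.uniqueDiffWithinAt hy))) hx (mem_ball_self hr)
  simpa [hΦ0] using this

/-- A solution of the Gauss-Codazzi equations is locally conformal to the flat metric given by the
value of `G` at the base point. -/
theorem exists_conformal_map (h : IsGaussCodazziOn G B Ω) {x₀ : V} (hx₀ : x₀ ∈ Ω) :
    ∃ U, IsOpen U ∧ x₀ ∈ U ∧ U ⊆ Ω ∧ ∃ (f : V → V) (b : V → ℝ), ContDiffOn ℝ ∞ f U ∧
      ContDiffOn ℝ ∞ b U ∧ (∀ x ∈ U, 0 < b x) ∧ ∀ x ∈ U, ∀ X Y,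
        G x X Y = b x ^ 2 * G x₀ (fderiv ℝ f x X) (fderiv ℝ f x Y) := by
  obtain ⟨r, hr, hsub, Φ, hΦ0, hΦs, hΦd, hΦm⟩ := h.exists_parallel_frame hx₀
  have hinv : ∀ x ∈ ball x₀ r, (Φ x).IsInvertible := by
    intro x hx
    -- A frame that preserves a nondegenerate form has no kernel.
    have hinj : Function.Injective (Φ x) := by
      rw [injective_iff_map_eq_zero]
      intro e he
      have h0 : ∀ e', tractorMetric (G x₀) e e' = 0 := fun e' ↦ by
        rw [← hΦm x hx, he]; simp [tractorMetric]
      have h1 := h0 (0, 0, 1)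
      have h2 := h0 (1, 0, 0)
      have h3 := h0 (0, e.2.1, 0)
      simp only [tractorMetric, map_zero, mul_zero, mul_one, add_zero, zero_add] at h1 h2 h3
      have h4 : e.2.1 = 0 := by
        by_contra hne
        exact (h.metric.pos x₀ hx₀ _ hne).ne' h3
      ext
      · exact h1
      · rw [h4]; rfl
      · exact h2
    exact ⟨(LinearEquiv.ofInjectiveEndo (Φ x).toLinearMap hinj).toContinuousLinearEquiv, by
      ext <;> rfl⟩
  -- The developing map: the canonical null section (0, 0, 1), expressed in the parallel frame.
  let Z : V → ℝ × V × ℝ := fun x ↦ (Φ x).inverse (0, 0, 1)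
  have hZs : ContDiffOn ℝ ∞ Z (ball x₀ r) := by
    have : ContDiffOn ℝ ∞ (fun x ↦ (Φ x).inverse) (ball x₀ r) := fun x hx ↦
      ((hinv x hx).contDiffAt_map_inverse.comp x
        (hΦs.contDiffAt (isOpen_ball.mem_nhds hx))).contDiffWithinAt
    exact this.clm_apply contDiffOn_const
  have hΦZ : ∀ x ∈ ball x₀ r, Φ x (Z x) = (0, 0, 1) := by
    intro x hx
    obtain ⟨e, he⟩ := hinv x hx
    simp [Z, ← he]
  have hZd := fun {x} (hx : x ∈ ball x₀ r) ↦ differentiableAt_of_contDiffOn isOpen_ball hZs hx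
  -- Differentiate Φ Z = (0, 0, 1); the connection form sends (0, 0, 1) to (0, -X, 0). Since Φ
  -- preserves the tractor metric, Z is null and isometric for G, which is the content of the next
  -- two facts.
  have hΦZ' : ∀ x ∈ ball x₀ r, ∀ X, Φ x (fderiv ℝ Z x X) = (0, X, 0) := by
    intro x hx X
    have he : (fun y ↦ Φ y (Z y)) =ᶠ[𝓝 x] fun _ ↦ (0, 0, 1) := by
      filter_upwards [isOpen_ball.mem_nhds hx] with y hy using hΦZ y hy
    have h1 := DFunLike.congr_fun (he.fderiv_eq (𝕜 := ℝ)) X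
    rw [fderiv_clm_apply_apply (differentiableAt_of_contDiffOn isOpen_ball hΦs hx) (hZd hx),
      hΦd x hx, hΦZ x hx, tractorForm_apply] at h1
    rw [eq_neg_of_add_eq_zero_right (h1.trans (by simp))]
    ext <;> simp
  have hη : ∀ x ∈ ball x₀ r, 2 * ((Z x).1 * (Z x).2.2) + G x₀ (Z x).2.1 (Z x).2.1 = 0 := by
    intro x hx
    have := hΦm x hx (Z x) (Z x)
    rw [hΦZ x hx] at this
    simp [tractorMetric] at this
    linarith
  have hη' : ∀ x ∈ ball x₀ r, ∀ X Y, G x X Y = (fderiv ℝ Z x X).1 * (fderiv ℝ Z x Y).2.2 +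
      (fderiv ℝ Z x X).2.2 * (fderiv ℝ Z x Y).1 +
      G x₀ (fderiv ℝ Z x X).2.1 (fderiv ℝ Z x Y).2.1 := by
    intro x hx X Y
    have := hΦm x hx (fderiv ℝ Z x X) (fderiv ℝ Z x Y)
    rw [hΦZ' x hx, hΦZ' x hx] at this
    simpa [tractorMetric] using this
  have hy : ContDiffOn ℝ ∞ (fun x ↦ (Z x).2.1) (ball x₀ r) := hZs.snd.fst
  have hb : ContDiffOn ℝ ∞ (fun x ↦ (Z x).2.2) (ball x₀ r) := hZs.snd.snd
  -- At x₀ the frame is the identity, so the last coordinate of Z is 1 there and stays positive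
  -- nearby. Dividing the V-coordinate by it gives f.
  have hUo : IsOpen (ball x₀ r ∩ (fun x ↦ (Z x).2.2) ⁻¹' Set.Ioi 0) :=
    hb.continuousOn.isOpen_inter_preimage isOpen_ball isOpen_Ioi
  refine ⟨_, hUo, ⟨mem_ball_self hr, by simp [Z, hΦ0]⟩, fun x hx ↦ hsub hx.1,
    fun x ↦ (Z x).2.2⁻¹ • (Z x).2.1, fun x ↦ (Z x).2.2, ?_, hb.mono Set.inter_subset_left,
    fun x hx ↦ hx.2, ?_⟩
  · exact ((hb.mono Set.inter_subset_left).inv fun x hx ↦ ne_of_gt hx.2).smul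
      (hy.mono Set.inter_subset_left)
  rintro x ⟨hx, hbx⟩ X Y
  replace hbx : 0 < (Z x).2.2 := hbx
  have hZx := (hZd hx).hasFDerivAt
  have d1 := hZx.fst
  have d2 := hZx.snd.fst
  have d3 := hZx.snd.snd
  have hinvd : HasFDerivAt (fun y ↦ ((Z y).2.2)⁻¹) _ x :=
    (hasDerivAt_inv hbx.ne').comp_hasFDerivAt x d3
  have hf : HasFDerivAt (fun x ↦ (Z x).2.2⁻¹ • (Z x).2.1) _ x := hinvd.smul d2
  have hf' : ∀ X, fderiv ℝ (fun x ↦ (Z x).2.2⁻¹ • (Z x).2.1) x X =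
      (Z x).2.2⁻¹ • (fderiv ℝ Z x X).2.1 -
        (((Z x).2.2 ^ 2)⁻¹ * (fderiv ℝ Z x X).2.2) • (Z x).2.1 := by
    intro X
    rw [hf.fderiv]
    simp
    module
  -- The derivative of the null condition: dZ is orthogonal to Z. Hence the derivative of the scale
  -- b contributes nothing to the induced metric, and Z = b · (Z/b) gives G = b² G(x₀)(df, df).
  have hrel : ∀ X, (fderiv ℝ Z x X).1 * (Z x).2.2 + (Z x).1 * (fderiv ℝ Z x X).2.2 +
      G x₀ (Z x).2.1 (fderiv ℝ Z x X).2.1 = 0 := by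
    intro X
    have he : (fun y ↦ 2 * ((Z y).1 * (Z y).2.2) + G x₀ (Z y).2.1 (Z y).2.1) =ᶠ[𝓝 x]
        fun _ ↦ (0 : ℝ) := by
      filter_upwards [isOpen_ball.mem_nhds hx] with y hy using hη y hy
    have hgd : DifferentiableAt ℝ (fun y ↦ G x₀ (Z y).2.1 (Z y).2.1) x :=
      ((differentiableAt_const (G x₀)).clm_apply d2.differentiableAt).clm_apply d2.differentiableAt
    have hd : HasFDerivAt (fun y ↦ 2 * ((Z y).1 * (Z y).2.2) + G x₀ (Z y).2.1 (Z y).2.1) _ x :=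
      ((d1.mul d3).const_mul 2).add hgd.hasFDerivAt
    have h1 := DFunLike.congr_fun (he.fderiv_eq (𝕜 := ℝ)) X
    rw [hd.fderiv] at h1
    simp only [add_apply, smul_apply, ContinuousLinearMap.comp_apply,
      ContinuousLinearMap.coe_fst', ContinuousLinearMap.coe_snd', smul_eq_mul,
      fderiv_bilin_apply (differentiableAt_const (G x₀)) d2.differentiableAt d2.differentiableAt,
      d2.fderiv] at h1
    rw [h.metric.symm x₀ hx₀ (fderiv ℝ Z x X).2.1] at h1
    simp at h1
    linarith
  rw [hη' x hx, hf', hf']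
  simp only [map_sub, map_smul, sub_apply, smul_apply, smul_eq_mul]
  rw [h.metric.symm x₀ hx₀ (fderiv ℝ Z x X).2.1 (Z x).2.1]
  have e1 : G x₀ (Z x).2.1 (fderiv ℝ Z x X).2.1 =
      -((fderiv ℝ Z x X).1 * (Z x).2.2 + (Z x).1 * (fderiv ℝ Z x X).2.2) := by linarith [hrel X]
  have e2 : G x₀ (Z x).2.1 (fderiv ℝ Z x Y).2.1 =
      -((fderiv ℝ Z x Y).1 * (Z x).2.2 + (Z x).1 * (fderiv ℝ Z x Y).2.2) := by linarith [hrel Y]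
  have e3 : G x₀ (Z x).2.1 (Z x).2.1 = -(2 * ((Z x).1 * (Z x).2.2)) := by linarith [hη x hx]
  rw [e1, e2, e3]
  field_simp
  ring

end IsGaussCodazziOn

/-- Every positive definite symmetric form is the pullback of the Euclidean inner product by a
linear map. -/
theorem exists_linear_isometry {n : ℕ} {g : Model n →L[ℝ] Model n →L[ℝ] ℝ}
    (hs : ∀ v w, g v w = g w v) (hp : ∀ v, v ≠ 0 → 0 < g v v) :
    ∃ A : Model n →L[ℝ] Model n, ∀ v w, inner ℝ (A v) (A w) = g v w := by
  let β : LinearMap.BilinForm ℝ (Model n) :=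
    LinearMap.mk₂ ℝ (fun v w ↦ g v w) (by simp) (by simp) (by simp) (by simp)
  obtain ⟨v, hv⟩ := LinearMap.BilinForm.exists_orthogonal_basis (B := β) ⟨fun a b ↦ hs a b⟩
  let e : OrthonormalBasis (Fin (Module.finrank ℝ (Model n))) ℝ (Model n) :=
    stdOrthonormalBasis ℝ (Model n)
  -- The square roots match the lengths of the g-orthogonal basis v to those of the orthonormal
  -- basis e.
  let A : Model n →ₗ[ℝ] Model n := v.constr ℝ fun i ↦ Real.sqrt (g (v i) (v i)) • e i
  have hA : ∀ i, A (v i) = Real.sqrt (g (v i) (v i)) • e i := fun i ↦ v.constr_basis ℝ _ i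
  have hEq : (innerₗ (Model n)).compl₁₂ A A = β := by
    refine v.ext fun i ↦ v.ext fun j ↦ ?_
    simp only [LinearMap.compl₁₂_apply, innerₗ_apply_apply, hA, real_inner_smul_left,
      real_inner_smul_right]
    by_cases hij : i = j
    · subst hij
      rw [real_inner_self_eq_norm_sq, e.norm_eq_one]
      have := Real.mul_self_sqrt (hp _ (v.ne_zero i)).le
      simp [this, β]
    · rw [e.inner_eq_zero hij]
      simpa using (hv hij).symm
  exact ⟨LinearMap.toContinuousLinearMap A, fun a b ↦
    LinearMap.congr_fun (LinearMap.congr_fun hEq a) b⟩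

end Tractor

end ConfFlat

end

noncomputable section

namespace ConfFlat

open Topology

/-! ### Charts, transition maps and coordinate expressions -/

section Charts

variable {n : ℕ} {M : Type*} [TopologicalSpace M]
  {φ χ : OpenPartialHomeomorph M (Model n)}

/-- The domain of the transition map from `χ` to `φ`. -/
def transitionDomain (χ φ : OpenPartialHomeomorph M (Model n)) : Set (Model n) :=
  χ.target ∩ χ.symm ⁻¹' φ.source

theorem isOpen_transitionDomain : IsOpen (transitionDomain χ φ) :=
  χ.symm.isOpen_inter_preimage φ.open_source

theorem apply_mem_transitionDomain {p : M} (hχ : p ∈ χ.source) (hφ : p ∈ φ.source) :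
    χ p ∈ transitionDomain χ φ :=
  ⟨χ.map_source hχ, by simpa [χ.left_inv hχ] using hφ⟩

variable [ChartedSpace (Model n) M]

/-- The derivative of a chart, as an endomorphism of the model space. -/
def chartDeriv (φ : OpenPartialHomeomorph M (Model n)) (p : M) : Model n →L[ℝ] Model n :=
  mfderiv 𝓘(ℝ, Model n) 𝓘(ℝ, Model n) φ p

/-- The derivative of the inverse of a chart, as an endomorphism of the model space. -/
def chartSymmDeriv (φ : OpenPartialHomeomorph M (Model n)) (y : Model n) : Model n →L[ℝ] Model n :=
  mfderiv 𝓘(ℝ, Model n) 𝓘(ℝ, Model n) φ.symm y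

/-- The value of a bilinear field at a point, as a form on the model space. -/
def BilinField.at (T : BilinField n M) (p : M) : Model n →L[ℝ] Model n →L[ℝ] ℝ := T p

/-- The value of an endomorphism field at a point, as an endomorphism of the model space. -/
def EndField.at (B : EndField n M) (p : M) : Model n →L[ℝ] Model n := B p

theorem BilinField.inChart_apply (T : BilinField n M) (φ : OpenPartialHomeomorph M (Model n))
    (y v w : Model n) : T.inChart φ y v w =
      BilinField.at T (φ.symm y) (chartSymmDeriv φ y v) (chartSymmDeriv φ y w) := rfl

theorem EndField.inChart_apply (B : EndField n M) (φ : OpenPartialHomeomorph M (Model n))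
    (y v : Model n) : B.inChart φ y v =
      chartDeriv φ (φ.symm y) (EndField.at B (φ.symm y) (chartSymmDeriv φ y v)) := rfl

theorem pullbackEuclidean_apply (φ : OpenPartialHomeomorph M (Model n)) (p : M) (v w : Model n) :
    BilinField.at (pullbackEuclidean φ) p v w =
      inner ℝ (chartDeriv φ p v) (chartDeriv φ p w) := rfl

theorem mdifferentiable_of_mem (hφ : φ ∈ IsManifold.maximalAtlas 𝓘(ℝ, Model n) ∞ M) :
    φ.MDifferentiable 𝓘(ℝ, Model n) 𝓘(ℝ, Model n) :=
  ⟨(contMDiffOn_of_mem_maximalAtlas hφ).mdifferentiableOn (by simp),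
    (contMDiffOn_symm_of_mem_maximalAtlas hφ).mdifferentiableOn (by simp)⟩

theorem chartSymmDeriv_chartDeriv (hφ : φ ∈ IsManifold.maximalAtlas 𝓘(ℝ, Model n) ∞ M) {p : M}
    (hp : p ∈ φ.source) (v : Model n) : chartSymmDeriv φ (φ p) (chartDeriv φ p v) = v :=
  DFunLike.congr_fun ((mdifferentiable_of_mem hφ).symm_comp_deriv hp) v

theorem chartDeriv_chartSymmDeriv (hφ : φ ∈ IsManifold.maximalAtlas 𝓘(ℝ, Model n) ∞ M)
    {y : Model n} (hy : y ∈ φ.target) (v : Model n) :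
    chartDeriv φ (φ.symm y) (chartSymmDeriv φ y v) = v :=
  DFunLike.congr_fun ((mdifferentiable_of_mem hφ).comp_symm_deriv hy) v

theorem chartSymmDeriv_chartDeriv_symm (hφ : φ ∈ IsManifold.maximalAtlas 𝓘(ℝ, Model n) ∞ M)
    {y : Model n} (hy : y ∈ φ.target) (v : Model n) :
    chartSymmDeriv φ y (chartDeriv φ (φ.symm y) v) = v := by
  have := chartSymmDeriv_chartDeriv hφ (φ.map_target hy) v
  rwa [φ.right_inv hy] at this

theorem BilinField.at_eq_inChart (hφ : φ ∈ IsManifold.maximalAtlas 𝓘(ℝ, Model n) ∞ M)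
    (T : BilinField n M) {p : M} (hp : p ∈ φ.source) (v w : Model n) :
    BilinField.at T p v w = T.inChart φ (φ p) (chartDeriv φ p v) (chartDeriv φ p w) := by
  rw [BilinField.inChart_apply, φ.left_inv hp, chartSymmDeriv_chartDeriv hφ hp,
    chartSymmDeriv_chartDeriv hφ hp]

theorem contDiffOn_transition (hφ : φ ∈ IsManifold.maximalAtlas 𝓘(ℝ, Model n) ∞ M)
    (hχ : χ ∈ IsManifold.maximalAtlas 𝓘(ℝ, Model n) ∞ M) :
    ContDiffOn ℝ ∞ (φ ∘ χ.symm) (transitionDomain χ φ) := by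
  rw [← contMDiffOn_iff_contDiffOn]
  exact (contMDiffOn_of_mem_maximalAtlas hφ).comp
    ((contMDiffOn_symm_of_mem_maximalAtlas hχ).mono Set.inter_subset_left)
    fun y hy ↦ hy.2

theorem fderiv_transition (hφ : φ ∈ IsManifold.maximalAtlas 𝓘(ℝ, Model n) ∞ M)
    (hχ : χ ∈ IsManifold.maximalAtlas 𝓘(ℝ, Model n) ∞ M) {y : Model n}
    (hy : y ∈ transitionDomain χ φ) (v : Model n) :
    fderiv ℝ (φ ∘ χ.symm) y v = chartDeriv φ (χ.symm y) (chartSymmDeriv χ y v) := by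
  rw [← mfderiv_eq_fderiv]
  have := mfderiv_comp y ((mdifferentiable_of_mem hφ).mdifferentiableAt hy.2)
    ((mdifferentiable_of_mem hχ).mdifferentiableAt_symm hy.1)
  exact DFunLike.congr_fun this v

theorem bijective_fderiv_transition (hφ : φ ∈ IsManifold.maximalAtlas 𝓘(ℝ, Model n) ∞ M)
    (hχ : χ ∈ IsManifold.maximalAtlas 𝓘(ℝ, Model n) ∞ M) {y : Model n}
    (hy : y ∈ transitionDomain χ φ) : Function.Bijective (fderiv ℝ (φ ∘ χ.symm) y) := by
  refine Function.bijective_iff_has_inverse.2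
    ⟨fun v ↦ chartDeriv χ (χ.symm y) (chartSymmDeriv φ (φ (χ.symm y)) v), fun v ↦ ?_, fun v ↦ ?_⟩
  · beta_reduce
    rw [fderiv_transition hφ hχ hy, chartSymmDeriv_chartDeriv hφ hy.2,
      chartDeriv_chartSymmDeriv hχ hy.1]
  · rw [fderiv_transition hφ hχ hy, chartSymmDeriv_chartDeriv_symm hχ hy.1]
    have := chartDeriv_chartSymmDeriv hφ (φ.map_source hy.2) v
    rwa [φ.left_inv hy.2] at this

theorem BilinField.inChart_transition (hφ : φ ∈ IsManifold.maximalAtlas 𝓘(ℝ, Model n) ∞ M)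
    (hχ : χ ∈ IsManifold.maximalAtlas 𝓘(ℝ, Model n) ∞ M) (T : BilinField n M) {y : Model n}
    (hy : y ∈ transitionDomain χ φ) :
    T.inChart χ y = (T.inChart φ ((φ ∘ χ.symm) y)).bilinearComp (fderiv ℝ (φ ∘ χ.symm) y)
      (fderiv ℝ (φ ∘ χ.symm) y) := by
  ext v w
  rw [ContinuousLinearMap.bilinearComp_apply, BilinField.inChart_apply,
    fderiv_transition hφ hχ hy, fderiv_transition hφ hχ hy, Function.comp_apply,
    BilinField.at_eq_inChart hφ T hy.2]

theorem EndField.inChart_transition (hφ : φ ∈ IsManifold.maximalAtlas 𝓘(ℝ, Model n) ∞ M)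
    (hχ : χ ∈ IsManifold.maximalAtlas 𝓘(ℝ, Model n) ∞ M) (B : EndField n M) {y : Model n}
    (hy : y ∈ transitionDomain χ φ) (v : Model n) :
    fderiv ℝ (φ ∘ χ.symm) y (B.inChart χ y v) =
      B.inChart φ ((φ ∘ χ.symm) y) (fderiv ℝ (φ ∘ χ.symm) y v) := by
  rw [EndField.inChart_apply, EndField.inChart_apply, fderiv_transition hφ hχ hy,
    fderiv_transition hφ hχ hy, chartSymmDeriv_chartDeriv_symm hχ hy.1, Function.comp_apply,
    chartSymmDeriv_chartDeriv hφ hy.2, φ.left_inv hy.2]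

/-- Read in another chart χ, the flat metric of φ is the transition pullback of a constant form;
this reduces its Osgood-Stowe tensor to the Euclidean computation. -/
theorem isPullbackOn_pullbackEuclidean (hφ : φ ∈ IsManifold.maximalAtlas 𝓘(ℝ, Model n) ∞ M)
    (hχ : χ ∈ IsManifold.maximalAtlas 𝓘(ℝ, Model n) ∞ M) :
    IsPullbackOn (φ ∘ χ.symm) (BilinField.inChart (pullbackEuclidean φ) χ)
      (fun _ ↦ euclid (Model n)) (transitionDomain χ φ) φ.target where
  isOpen := isOpen_transitionDomain
  smooth := contDiffOn_transition hφ hχ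
  mapsTo := fun _ hy ↦ φ.map_source hy.2
  bijective := fun _ hy ↦ bijective_fderiv_transition hφ hχ hy
  metric := isMetricOn_euclid φ.open_target
  eq := fun y hy ↦ by
    ext v w
    rw [BilinField.inChart_apply, pullbackEuclidean_apply, ContinuousLinearMap.bilinearComp_apply,
      fderiv_transition hφ hχ hy, fderiv_transition hφ hχ hy, euclid_apply]

section Manifold

variable [IsManifold 𝓘(ℝ, Model n) ∞ M]

theorem chartAt_mem (p : M) :
    chartAt (Model n) p ∈ IsManifold.maximalAtlas 𝓘(ℝ, Model n) ∞ M :=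
  IsManifold.chart_mem_maximalAtlas p

theorem chartDeriv_chartAt_self (p : M) (v : Model n) :
    chartDeriv (chartAt (Model n) p) p v = v := mfderiv_chartAt_self p v

theorem chartSymmDeriv_chartAt_self (p : M) (v : Model n) :
    chartSymmDeriv (chartAt (Model n) p) (chartAt (Model n) p p) v = v := by
  have := chartSymmDeriv_chartDeriv (chartAt_mem p) (mem_chart_source (Model n) p) v
  rwa [chartDeriv_chartAt_self] at this

theorem fderiv_transition_chartAt (hφ : φ ∈ IsManifold.maximalAtlas 𝓘(ℝ, Model n) ∞ M) {p : M}
    (hp : p ∈ φ.source) (v : Model n) :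
    fderiv ℝ (φ ∘ (chartAt (Model n) p).symm) (chartAt (Model n) p p) v = chartDeriv φ p v := by
  rw [fderiv_transition hφ (chartAt_mem p)
    (apply_mem_transitionDomain (mem_chart_source (Model n) p) hp), chartSymmDeriv_chartAt_self,
    (chartAt (Model n) p).left_inv (mem_chart_source (Model n) p)]

variable (g : Bundle.ContMDiffRiemannianMetric 𝓘(ℝ, Model n) ∞ (Model n)
  (fun p : M ↦ TangentSpace 𝓘(ℝ, Model n) p))

/-- The coordinate fields are smooth sections of the tangent bundle along φ⁻¹, because they are
images of constant fields under its tangent map; a smooth metric evaluated on them is smooth. -/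
theorem contDiffOn_inChart (hφ : φ ∈ IsManifold.maximalAtlas 𝓘(ℝ, Model n) ∞ M) :
    ContDiffOn ℝ ∞ (BilinField.inChart g.inner φ) φ.target := by
  have : IsManifold 𝓘(ℝ, Model n) 1 M := IsManifold.of_le (n := ∞) (by norm_cast)
  have hs := contMDiffOn_symm_of_mem_maximalAtlas hφ
  have hsec : ∀ v : Model n, ContMDiffOn 𝓘(ℝ, Model n) 𝓘(ℝ, Model n).tangent ∞
      (fun y ↦ (⟨φ.symm y, mfderiv 𝓘(ℝ, Model n) 𝓘(ℝ, Model n) φ.symm y v⟩ :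
        TangentBundle 𝓘(ℝ, Model n) M)) φ.target := by
    intro v
    have h1 := hs.contMDiffOn_tangentMapWithin (m := ∞) (by simp)
      φ.open_target.uniqueMDiffOn
    have h2 : ContMDiffOn 𝓘(ℝ, Model n) 𝓘(ℝ, Model n).tangent ∞
        (fun y ↦ (⟨y, v⟩ : TangentBundle 𝓘(ℝ, Model n) (Model n))) φ.target :=
      contMDiffOn_vectorSpace_iff_contDiffOn.2 contDiffOn_const
    refine (h1.comp h2 fun y hy ↦ hy).congr fun y hy ↦ ?_
    simp only [Function.comp_apply, tangentMapWithin]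
    rw [mfderivWithin_of_isOpen φ.open_target hy]
  rw [contDiffOn_clm_apply]
  intro v
  rw [contDiffOn_clm_apply]
  intro w
  rw [← contMDiffOn_iff_contDiffOn]
  intro y hy
  have h3 : ContMDiffWithinAt 𝓘(ℝ, Model n) (𝓘(ℝ, Model n).prod 𝓘(ℝ)) ∞
      (fun y ↦ Bundle.TotalSpace.mk' ℝ (E := Bundle.Trivial M ℝ) (φ.symm y)
        (g.inner (φ.symm y) (mfderiv 𝓘(ℝ, Model n) 𝓘(ℝ, Model n) φ.symm y v)
          (mfderiv 𝓘(ℝ, Model n) 𝓘(ℝ, Model n) φ.symm y w))) φ.target y := by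
    apply ContMDiffWithinAt.clm_bundle_apply₂ (F₁ := Model n) (F₂ := Model n)
    · exact ContMDiffAt.comp_contMDiffWithinAt y g.contMDiff.contMDiffAt (hs y hy)
    · exact hsec v y hy
    · exact hsec w y hy
  simp only [Bundle.contMDiffWithinAt_totalSpace] at h3
  exact h3.2

theorem isMetricOn_inChart (hφ : φ ∈ IsManifold.maximalAtlas 𝓘(ℝ, Model n) ∞ M) :
    IsMetricOn (BilinField.inChart g.inner φ) φ.target where
  isOpen := φ.open_target
  smooth := contDiffOn_inChart g hφ
  symm := fun y _ v w ↦ g.symm (φ.symm y) _ _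
  pos := fun y hy v hv ↦ g.pos (φ.symm y) _ fun h0 ↦ hv (by
    rw [← chartDeriv_chartSymmDeriv hφ hy v]
    exact (congrArg _ h0).trans (map_zero _))

/-- This makes the naturality results apply to transition maps, so that tensors defined through the
preferred chart can be read in any chart. -/
theorem isPullbackOn_inChart (hφ : φ ∈ IsManifold.maximalAtlas 𝓘(ℝ, Model n) ∞ M)
    (hχ : χ ∈ IsManifold.maximalAtlas 𝓘(ℝ, Model n) ∞ M) :
    IsPullbackOn (φ ∘ χ.symm) (BilinField.inChart g.inner χ) (BilinField.inChart g.inner φ)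
      (transitionDomain χ φ) φ.target where
  isOpen := isOpen_transitionDomain
  smooth := contDiffOn_transition hφ hχ
  mapsTo := fun _ hy ↦ φ.map_source hy.2
  bijective := fun _ hy ↦ bijective_fderiv_transition hφ hχ hy
  metric := isMetricOn_inChart g hφ
  eq := fun _ hy ↦ BilinField.inChart_transition hφ hχ g.inner hy

theorem isConfEuclidOn_inChart {u : M → ℝ} (h : IsConformalChart g.inner φ u) :
    IsConfEuclidOn (BilinField.inChart g.inner φ) (u ∘ φ.symm) φ.target where
  isOpen := φ.open_target
  smooth := by
    rw [← contMDiffOn_iff_contDiffOn]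
    exact h.smooth.comp (contMDiffOn_symm_of_mem_maximalAtlas h.mem_maximalAtlas)
      fun y hy ↦ φ.map_target hy
  eq := fun y hy ↦ by
    ext v w
    have hc : BilinField.at g.inner (φ.symm y) = Real.exp (2 * u (φ.symm y)) •
        BilinField.at (pullbackEuclidean φ) (φ.symm y) := h.conformal _ (φ.map_target hy)
    rw [BilinField.inChart_apply, hc, smul_apply, smul_apply, pullbackEuclidean_apply,
      chartDeriv_chartSymmDeriv h.mem_maximalAtlas hy,
      chartDeriv_chartSymmDeriv h.mem_maximalAtlas hy]
    rfl

end Manifold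

end Charts

end ConfFlat

end

noncomputable section

namespace ConfFlat

open Topology

theorem osgoodStoweLoc_congr {V : Type*} [NormedAddCommGroup V] [NormedSpace ℝ V]
    [FiniteDimensional ℝ V] (G : V → V →L[ℝ] V →L[ℝ] ℝ) {u u' : V → ℝ} {x : V}
    (h : u =ᶠ[𝓝 x] u') : osgoodStoweLoc G u x = osgoodStoweLoc G u' x := by
  have h1 := h.fderiv_eq (𝕜 := ℝ)
  have h2 := (h.fderiv (𝕜 := ℝ)).fderiv_eq (𝕜 := ℝ)
  simp only [osgoodStoweLoc, hessian, h1, h2]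

/-! ### Global tensors in arbitrary charts; conformal flatness implies Gauss-Codazzi -/

section Tensors

variable {n : ℕ} {M : Type*} [TopologicalSpace M] [ChartedSpace (Model n) M]
  {φ : OpenPartialHomeomorph M (Model n)} {p : M}

theorem chartAt_mem_transitionDomain (hp : p ∈ φ.source) :
    chartAt (Model n) p p ∈ transitionDomain (chartAt (Model n) p) φ :=
  apply_mem_transitionDomain (mem_chart_source (Model n) p) hp

theorem chartAt_symm_self (p : M) :
    (chartAt (Model n) p).symm (chartAt (Model n) p p) = p :=
  (chartAt (Model n) p).left_inv (mem_chart_source (Model n) p)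

variable [IsManifold 𝓘(ℝ, Model n) ∞ M]

theorem osgoodStowe_pullbackEuclidean_apply
    (hφ : φ ∈ IsManifold.maximalAtlas 𝓘(ℝ, Model n) ∞ M) {u : M → ℝ}
    (hu : ContDiffOn ℝ ∞ (u ∘ φ.symm) φ.target) (hp : p ∈ φ.source) (v w : Model n) :
    BilinField.at (osgoodStowe (pullbackEuclidean φ) u) p v w =
      osgoodStoweLoc (fun _ ↦ euclid (Model n)) (u ∘ φ.symm) (φ p) (chartDeriv φ p v)
        (chartDeriv φ p w) := by
  have h := (isPullbackOn_pullbackEuclidean hφ (chartAt_mem p)).osgoodStoweLoc_eq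
    (chartAt_mem_transitionDomain hp) hu
  -- The two coordinate expressions of u need agree only on the overlap of the charts; the tensor
  -- depends only on the germ of u.
  have hc : u ∘ (chartAt (Model n) p).symm =ᶠ[𝓝 (chartAt (Model n) p p)]
      (u ∘ φ.symm) ∘ φ ∘ (chartAt (Model n) p).symm := by
    filter_upwards [isOpen_transitionDomain.mem_nhds (chartAt_mem_transitionDomain hp)] with y hy
    simp only [Function.comp_apply, φ.left_inv hy.2]
  rw [← osgoodStoweLoc_congr _ hc] at h
  refine (DFunLike.congr_fun (DFunLike.congr_fun h v) w).trans ?_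
  rw [ContinuousLinearMap.bilinearComp_apply, fderiv_transition_chartAt hφ hp,
    fderiv_transition_chartAt hφ hp, Function.comp_apply, chartAt_symm_self]

variable (g : Bundle.ContMDiffRiemannianMetric 𝓘(ℝ, Model n) ∞ (Model n)
  (fun p : M ↦ TangentSpace 𝓘(ℝ, Model n) p))

theorem schouten_apply (hφ : φ ∈ IsManifold.maximalAtlas 𝓘(ℝ, Model n) ∞ M) (hp : p ∈ φ.source)
    (v w : Model n) : BilinField.at (schouten g.inner) p v w =
      schoutenLoc (BilinField.inChart g.inner φ) (φ p) (chartDeriv φ p v) (chartDeriv φ p w) := by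
  have h := (isPullbackOn_inChart g hφ (chartAt_mem p)).schoutenLoc_eq
    (chartAt_mem_transitionDomain hp)
  refine (DFunLike.congr_fun (DFunLike.congr_fun h v) w).trans ?_
  rw [ContinuousLinearMap.bilinearComp_apply, fderiv_transition_chartAt hφ hp,
    fderiv_transition_chartAt hφ hp, Function.comp_apply, chartAt_symm_self]

theorem scalarCurvature_eq (hφ : φ ∈ IsManifold.maximalAtlas 𝓘(ℝ, Model n) ∞ M)
    (hp : p ∈ φ.source) :
    scalarCurvature g.inner p = scalarLoc (BilinField.inChart g.inner φ) (φ p) := by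
  have h := (isPullbackOn_inChart g hφ (chartAt_mem p)).scalarLoc_eq
    (chartAt_mem_transitionDomain hp)
  rwa [Function.comp_apply, chartAt_symm_self] at h

theorem Rm_eq (hφ : φ ∈ IsManifold.maximalAtlas 𝓘(ℝ, Model n) ∞ M) (hp : p ∈ φ.source)
    (X Y Z W : Model n) : Rm g.inner p X Y Z W =
      BilinField.inChart g.inner φ (φ p) (curvatureOp (BilinField.inChart g.inner φ) (φ p)
        (chartDeriv φ p X) (chartDeriv φ p Y) (chartDeriv φ p Z)) (chartDeriv φ p W) := by
  have h := (isPullbackOn_inChart g hφ (chartAt_mem p)).fderiv_curvatureOp_apply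
    (chartAt_mem_transitionDomain hp) X Y Z
  simp only [fderiv_transition_chartAt hφ hp, Function.comp_apply, chartAt_symm_self] at h
  rw [← h, ← BilinField.at_eq_inChart hφ _ hp]
  rfl

theorem inChart_schouten (hφ : φ ∈ IsManifold.maximalAtlas 𝓘(ℝ, Model n) ∞ M) {y : Model n}
    (hy : y ∈ φ.target) :
    BilinField.inChart (schouten g.inner) φ y = schoutenLoc (BilinField.inChart g.inner φ) y := by
  ext v w
  rw [BilinField.inChart_apply, schouten_apply g hφ (φ.map_target hy), φ.right_inv hy,
    chartDeriv_chartSymmDeriv hφ hy, chartDeriv_chartSymmDeriv hφ hy]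

theorem isInvertible_at (p : M) : (BilinField.at g.inner p).IsInvertible :=
  isInvertible_of_pos fun v hv ↦ g.pos p v hv

theorem lower_raise (T : BilinField n M) : lower g.inner (raise g.inner T) = T := by
  funext p
  obtain ⟨e, he⟩ := isInvertible_at g p
  have : BilinField.at g.inner p ∘L (BilinField.at g.inner p).inverse ∘L BilinField.at T p =
      BilinField.at T p := by
    ext v w
    simp [← he]
  exact this

theorem inChart_raise_apply (hφ : φ ∈ IsManifold.maximalAtlas 𝓘(ℝ, Model n) ∞ M)
    (T : BilinField n M) {y : Model n} (hy : y ∈ φ.target) (v w : Model n) :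
    BilinField.inChart g.inner φ y (EndField.inChart (raise g.inner T) φ y v) w =
      BilinField.inChart T φ y v w := by
  rw [BilinField.inChart_apply, EndField.inChart_apply, chartSymmDeriv_chartDeriv_symm hφ hy,
    BilinField.inChart_apply]
  exact DFunLike.congr_fun (DFunLike.congr_fun (congrFun (lower_raise g T) (φ.symm y)) _) _

theorem inChart_raise (hφ : φ ∈ IsManifold.maximalAtlas 𝓘(ℝ, Model n) ∞ M)
    (T : BilinField n M) {y : Model n} (hy : y ∈ φ.target) :
    EndField.inChart (raise g.inner T) φ y =
      (BilinField.inChart g.inner φ y).inverse ∘L BilinField.inChart T φ y := by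
  have hm := isMetricOn_inChart g hφ
  ext1 v
  refine hm.ext_inner hy fun w ↦ ?_
  obtain ⟨e, he⟩ := hm.isInvertible hy
  rw [inChart_raise_apply g hφ T hy]
  simp [← he]

theorem inChart_raise_schouten_apply (hφ : φ ∈ IsManifold.maximalAtlas 𝓘(ℝ, Model n) ∞ M)
    {y : Model n} (hy : y ∈ φ.target) (v w : Model n) :
    BilinField.inChart g.inner φ y
      (EndField.inChart (raise g.inner fun p ↦ (-2 : ℝ) • schouten g.inner p) φ y v) w =
      -2 * schoutenLoc (BilinField.inChart g.inner φ) y v w := by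
  rw [inChart_raise_apply g hφ _ hy, ← inChart_schouten g hφ hy]
  rfl

theorem contDiffOn_inChart_raise_schouten (hφ : φ ∈ IsManifold.maximalAtlas 𝓘(ℝ, Model n) ∞ M) :
    ContDiffOn ℝ ∞ (EndField.inChart (raise g.inner fun p ↦ (-2 : ℝ) • schouten g.inner p) φ)
      φ.target := by
  have hm := isMetricOn_inChart g hφ
  refine (hm.contDiffOn_inverse.clm_comp
    (hm.contDiffOn_schoutenLoc.const_smul (-2 : ℝ))).congr fun y hy ↦ ?_
  rw [inChart_raise g hφ _ hy, ← inChart_schouten g hφ hy]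
  rfl

theorem chartDeriv_extCovDeriv (hφ : φ ∈ IsManifold.maximalAtlas 𝓘(ℝ, Model n) ∞ M)
    (hp : p ∈ φ.source) {B : EndField n M}
    (hB : ∀ χ ∈ IsManifold.maximalAtlas 𝓘(ℝ, Model n) ∞ M,
      ContDiffOn ℝ ∞ (EndField.inChart B χ) χ.target) (X Y : Model n) :
    chartDeriv φ p (extCovDeriv g.inner B p X Y) =
      covDerivEnd (BilinField.inChart g.inner φ) (EndField.inChart B φ) (φ p) (chartDeriv φ p X)
        (chartDeriv φ p Y) -
      covDerivEnd (BilinField.inChart g.inner φ) (EndField.inChart B φ) (φ p) (chartDeriv φ p Y)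
        (chartDeriv φ p X) := by
  have h := (isPullbackOn_inChart g hφ (chartAt_mem p)).fderiv_covDerivEnd
    (chartAt_mem_transitionDomain hp)
    (differentiableAt_of_contDiffOn (chartAt (Model n) p).open_target (hB _ (chartAt_mem p))
      (mem_chart_target (Model n) p))
    (differentiableAt_of_contDiffOn φ.open_target (hB φ hφ)
      (by simpa only [Function.comp_apply, chartAt_symm_self] using φ.map_source hp))
    (fun y hy v ↦ EndField.inChart_transition hφ (chartAt_mem p) B hy v)
  simp only [fderiv_transition_chartAt hφ hp, Function.comp_apply, chartAt_symm_self] at h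
  rw [← h, ← h, ← map_sub]
  rfl

theorem finrank_model (n : ℕ) : Module.finrank ℝ (Model n) = n := finrank_euclideanSpace_fin

/-- The relation between the Osgood-Stowe and the Schouten tensors in a conformal chart. -/
theorem two_smul_osgoodStowe_sub (hn : 3 ≤ n) {u : M → ℝ} (h : IsConformalChart g.inner φ u)
    (hp : p ∈ φ.source) : (2 : ℝ) • osgoodStowe (pullbackEuclidean φ) u p -
      (scalarCurvature g.inner p / ((n : ℝ) * ((n : ℝ) - 1))) • g.inner p =
      (-2 : ℝ) • schouten g.inner p := by
  have hφ := h.mem_maximalAtlas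
  have hc := isConfEuclidOn_inChart g h
  have hloc := hc.two_smul_osgoodStoweLoc_sub (φ.map_source hp) (by rwa [finrank_model])
  rw [finrank_model] at hloc
  have key : (2 : ℝ) • BilinField.at (osgoodStowe (pullbackEuclidean φ) u) p -
      (scalarCurvature g.inner p / ((n : ℝ) * ((n : ℝ) - 1))) • BilinField.at g.inner p =
      (-2 : ℝ) • BilinField.at (schouten g.inner) p := by
    ext v w
    have := DFunLike.congr_fun (DFunLike.congr_fun hloc (chartDeriv φ p v)) (chartDeriv φ p w)
    simp only [sub_apply, smul_apply] at this ⊢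
    rw [osgoodStowe_pullbackEuclidean_apply hφ hc.smooth hp, schouten_apply g hφ hp,
      scalarCurvature_eq g hφ hp, BilinField.at_eq_inChart hφ _ hp, this]
  exact key

/-- The chart selected by choice and the given one satisfy the same identity, whose other terms
involve only g; so their Osgood-Stowe tensors coincide. -/
theorem OS_eq (hn : 3 ≤ n) {u : M → ℝ} (h : IsConformalChart g.inner φ u)
    (hp : p ∈ φ.source) : OS g.inner p = osgoodStowe (pullbackEuclidean φ) u p := by
  have hex : ∃ c : OpenPartialHomeomorph M (Model n) × (M → ℝ),
      IsConformalChart g.inner c.1 c.2 ∧ p ∈ c.1.source := ⟨(φ, u), h, hp⟩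
  have h1 := two_smul_osgoodStowe_sub g hn hex.choose_spec.1 hex.choose_spec.2
  have h2 := two_smul_osgoodStowe_sub g hn h hp
  rw [OS, dif_pos hex]
  exact smul_right_injective _ two_ne_zero (sub_left_injective (h1.trans h2.symm))

/-- The Gauss equation for the Schouten tensor in a chart. -/
theorem gauss_iff (hφ : φ ∈ IsManifold.maximalAtlas 𝓘(ℝ, Model n) ∞ M) (hp : p ∈ φ.source)
    (X Y Z W : Model n) :
    Rm g.inner p X Y Z W = -(1 / 2) * kulkarniNomizu (fun v w : Tan n p ↦ g.inner p v w)
      (fun v w : Tan n p ↦ lower g.inner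
        (raise g.inner fun p ↦ (-2 : ℝ) • schouten g.inner p) p v w) X Y Z W ↔
    BilinField.inChart g.inner φ (φ p) (curvatureOp (BilinField.inChart g.inner φ) (φ p)
        (chartDeriv φ p X) (chartDeriv φ p Y) (chartDeriv φ p Z)) (chartDeriv φ p W) =
      kulkarniNomizu (fun v w ↦ BilinField.inChart g.inner φ (φ p) v w)
        (fun v w ↦ schoutenLoc (BilinField.inChart g.inner φ) (φ p) v w) (chartDeriv φ p X)
        (chartDeriv φ p Y) (chartDeriv φ p Z) (chartDeriv φ p W) := by
  refine Eq.congr (Rm_eq g hφ hp X Y Z W) ?_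
  rw [lower_raise]
  have hs : (fun v w : Tan n p ↦ ((-2 : ℝ) • schouten g.inner p) v w) = fun v w ↦
      -2 * schoutenLoc (BilinField.inChart g.inner φ) (φ p) (chartDeriv φ p v)
        (chartDeriv φ p w) :=
    funext₂ fun v w ↦ congrArg (-2 * ·) (schouten_apply g hφ hp v w)
  have hg : (fun v w : Tan n p ↦ g.inner p v w) = fun v w ↦
      BilinField.inChart g.inner φ (φ p) (chartDeriv φ p v) (chartDeriv φ p w) :=
    funext₂ (BilinField.at_eq_inChart hφ _ hp)
  rw [hs, hg]
  simp only [kulkarniNomizu]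
  ring

/-- Both equations are tensorial, so at each point they may be checked in a conformal chart. -/
theorem solvesGaussCodazziAtInfinity_of_isLocallyConformallyFlat (hn : 3 ≤ n)
    (h : IsLocallyConformallyFlat g.inner) :
    SolvesGaussCodazziAtInfinity g.inner
      (raise g.inner fun p ↦ (-2 : ℝ) • schouten g.inner p) where
  gauss := fun p X Y Z W ↦ by
    obtain ⟨φ, u, hc, hp⟩ := h p
    exact (gauss_iff g hc.mem_maximalAtlas hp X Y Z W).2
      ((isConfEuclidOn_inChart g hc).gauss (φ.map_source hp) (by rwa [finrank_model]) _ _ _ _)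
  codazzi := fun p X Y ↦ by
    obtain ⟨φ, u, hc, hp⟩ := h p
    have hφ := hc.mem_maximalAtlas
    have hd := chartDeriv_extCovDeriv g hφ hp
      (fun χ hχ ↦ contDiffOn_inChart_raise_schouten g hχ) X Y
    rw [(isConfEuclidOn_inChart g hc).codazzi (φ.map_source hp) (by rwa [finrank_model])
      (differentiableAt_of_contDiffOn φ.open_target (contDiffOn_inChart_raise_schouten g hφ)
        (φ.map_source hp))
      (fun y hy ↦ inChart_raise_schouten_apply g hφ hy), sub_self] at hd
    have := chartSymmDeriv_chartDeriv hφ hp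
      (extCovDeriv g.inner (raise g.inner fun p ↦ (-2 : ℝ) • schouten g.inner p) p X Y)
    rw [hd, map_zero] at this
    exact this.symm

end Tensors

end ConfFlat

end

noncomputable section

namespace ConfFlat

open Topology

/-! ### From Gauss-Codazzi to conformal charts -/

section LocalGeometry

variable {V : Type*} [NormedAddCommGroup V] [NormedSpace ℝ V] [FiniteDimensional ℝ V]
  {G : V → V →L[ℝ] V →L[ℝ] ℝ} {Ω : Set V} {x : V}

/-- The Gauss equation forces the second tensor to be symmetric in dimension at least three. -/
theorem IsMetricOn.symm_of_gauss (hG : IsMetricOn G Ω) (hx : x ∈ Ω)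
    (hn : 3 ≤ Module.finrank ℝ V) {B : V →L[ℝ] V}
    (h : ∀ a b c, curvatureOp G x a b c =
      G x (B b) c • a - G x (B a) c • b + G x b c • B a - G x a c • B b) (v w : V) :
    G x (B v) w = G x (B w) v := by
  -- Let A be twice the skew part of G(B·,·). The first Bianchi identity gives A(v,w) a + A(w,a) v +
  -- A(a,v) w = 0, and the trace over a is (n - 2) A(v,w) = 0.
  let A : V →L[ℝ] V →L[ℝ] ℝ := G x ∘L B - (G x ∘L B).flip
  have hA : ∀ b c, A b c = G x (B b) c - G x (B c) b := fun b c ↦ by simp [A]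
  have hop : A v w • ContinuousLinearMap.id ℝ V + (A w).smulRight v +
      (A.flip v).smulRight w = 0 := by
    ext a
    have hb := hG.bianchi hx a v w
    rw [h, h, h, hG.symm x hx w v, hG.symm x hx w a, hG.symm x hx v a] at hb
    simp only [add_apply, smul_apply, ContinuousLinearMap.id_apply,
      ContinuousLinearMap.smulRight_apply, ContinuousLinearMap.flip_apply, hA, zero_apply]
    linear_combination (norm := module) hb
  have htr := congrArg (traceCLM V) hop
  simp only [map_add, map_smul, map_zero, traceCLM_id, traceCLM_smulRight,
    ContinuousLinearMap.flip_apply, hA, smul_eq_mul] at htr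
  have hn' : (3 : ℝ) ≤ Module.finrank ℝ V := by exact_mod_cast hn
  have h2 : (Module.finrank ℝ V : ℝ) - 2 ≠ 0 := by linarith
  have : ((Module.finrank ℝ V : ℝ) - 2) * (G x (B v) w - G x (B w) v) = 0 := by
    linear_combination htr
  exact sub_eq_zero.1 ((mul_eq_zero.1 this).resolve_left h2)

/-- If the Schouten tensor solves the Gauss and Codazzi equations, then so does the associated
endomorphism field. -/
theorem IsMetricOn.isGaussCodazziOn (hG : IsMetricOn G Ω) (hn : 3 ≤ Module.finrank ℝ V)
    {B : V → V →L[ℝ] V} (hBs : ContDiffOn ℝ ∞ B Ω)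
    (hB : ∀ y ∈ Ω, ∀ v w, G y (B y v) w = -2 * schoutenLoc G y v w)
    (hgauss : ∀ y ∈ Ω, ∀ a b c d, G y (curvatureOp G y a b c) d =
      kulkarniNomizu (fun v w ↦ G y v w) (fun v w ↦ schoutenLoc G y v w) a b c d)
    (hcod : ∀ y ∈ Ω, ∀ a b, covDerivEnd G B y a b = covDerivEnd G B y b a) :
    IsGaussCodazziOn G (fun y ↦ (-1 / 2 : ℝ) • B y) Ω := by
  -- The factor -1/2 turns g⁻¹(-2P) into g⁻¹P, the normalisation for which the tractor connection is
  -- flat.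
  have hB' : ∀ y ∈ Ω, ∀ v w, G y (((-1 / 2 : ℝ) • B y) v) w = schoutenLoc G y v w := by
    intro y hy v w
    rw [smul_apply, map_smul, smul_apply, hB y hy, smul_eq_mul]
    ring
  have hg : ∀ y ∈ Ω, ∀ a b c, curvatureOp G y a b c =
      G y (((-1 / 2 : ℝ) • B y) b) c • a - G y (((-1 / 2 : ℝ) • B y) a) c • b +
        G y b c • ((-1 / 2 : ℝ) • B y) a - G y a c • ((-1 / 2 : ℝ) • B y) b := by
    intro y hy a b c
    refine hG.ext_inner hy fun d ↦ ?_
    have hβ := hB' y hy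
    generalize (-1 / 2 : ℝ) • B y = β at hβ ⊢
    rw [hgauss y hy]
    simp only [map_sub, map_add, map_smul, sub_apply, add_apply, smul_apply, hβ, kulkarniNomizu,
      smul_eq_mul]
    ring
  refine ⟨hG, hBs.const_smul _, fun y hy ↦ hG.symm_of_gauss hy hn (hg y hy), hg,
    fun y hy a b ↦ ?_⟩
  have hlin : ∀ a b, covDerivEnd G (fun y ↦ (-1 / 2 : ℝ) • B y) y a b =
      (-1 / 2 : ℝ) • covDerivEnd G B y a b := by
    intro a b
    simp only [covDerivEnd,
      fderiv_fun_const_smul (differentiableAt_of_contDiffOn hG.isOpen hBs hy), smul_apply, map_smul,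
      smul_add, smul_sub]
  rw [hlin, hlin, hcod y hy]

end LocalGeometry

section ConformalChart

variable {n : ℕ}

/-- A metric solving the Gauss-Codazzi equations is locally the pullback of a conformal multiple of
the Euclidean metric. -/
theorem IsGaussCodazziOn.exists_openPartialHomeomorph {G : Model n → Model n →L[ℝ] Model n →L[ℝ] ℝ}
    {B : Model n → Model n →L[ℝ] Model n} {Ω : Set (Model n)} (h : IsGaussCodazziOn G B Ω)
    {x₀ : Model n} (hx₀ : x₀ ∈ Ω) :
    ∃ e : OpenPartialHomeomorph (Model n) (Model n), x₀ ∈ e.source ∧ e.source ⊆ Ω ∧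
      e ∈ contDiffGroupoid ∞ 𝓘(ℝ, Model n) ∧ ∃ b : Model n → ℝ, ContDiffOn ℝ ∞ b e.source ∧
        (∀ x ∈ e.source, 0 < b x) ∧ ∀ x ∈ e.source, ∀ X Y,
          G x X Y = b x ^ 2 * inner ℝ (fderiv ℝ e x X) (fderiv ℝ e x Y) := by
  obtain ⟨U, hU, hxU, hUΩ, f, b, hf, hb, hbp, hfb⟩ := h.exists_conformal_map hx₀
  obtain ⟨A, hA⟩ := exists_linear_isometry (h.metric.symm x₀ hx₀) (h.metric.pos x₀ hx₀)
  have hF : ContDiffOn ℝ ∞ (A ∘ f) U := A.contDiff.comp_contDiffOn hf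
  have hFd : ∀ x ∈ U, ∀ X, fderiv ℝ (A ∘ f) x X = A (fderiv ℝ f x X) := fun x hx X ↦ by
    rw [fderiv_comp x A.differentiableAt (differentiableAt_of_contDiffOn hU hf hx)]
    simp
  have hmet : ∀ x ∈ U, ∀ X Y, G x X Y =
      b x ^ 2 * inner ℝ (fderiv ℝ (A ∘ f) x X) (fderiv ℝ (A ∘ f) x Y) := fun x hx X Y ↦ by
    rw [hfb x hx, hFd x hx, hFd x hx, hA]
  -- A vector killed by the derivative would have G-length zero. Invertibility on all of U, not only
  -- at x₀, later makes the inverse smooth on the whole target; hence the restriction to U below.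
  have hinv : ∀ x ∈ U, ∃ e : Model n ≃L[ℝ] Model n, (e : Model n →L[ℝ] Model n) =
      fderiv ℝ (A ∘ f) x := fun x hx ↦ by
    have hinj : Function.Injective (fderiv ℝ (A ∘ f) x).toLinearMap := by
      rw [injective_iff_map_eq_zero]
      intro X hX
      by_contra h0
      have := h.metric.pos x (hUΩ hx) X h0
      rw [hmet x hx, show fderiv ℝ (A ∘ f) x X = 0 from hX] at this
      simp at this
    exact ⟨(LinearEquiv.ofInjectiveEndo _ hinj).toContinuousLinearEquiv, by ext; rfl⟩
  have hat : ∀ x ∈ U, ContDiffAt ℝ ∞ (A ∘ f) x := fun x hx ↦ hF.contDiffAt (hU.mem_nhds hx)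
  have hder : ∀ x ∈ U, HasFDerivAt (A ∘ f) (fderiv ℝ (A ∘ f) x) x := fun x hx ↦
    ((hat x hx).differentiableAt (by simp)).hasFDerivAt
  obtain ⟨E, hE⟩ := hinv x₀ hxU
  let e := ((hat x₀ hxU).toOpenPartialHomeomorph (A ∘ f) (f' := E) (hE ▸ hder x₀ hxU)
    (by simp)).restrOpen U hU
  have hcoe : (e : Model n → Model n) = A ∘ f := rfl
  have hsrc : e.source ⊆ U := Set.inter_subset_right
  refine ⟨e, ⟨ContDiffAt.mem_toOpenPartialHomeomorph_source _ _ _, hxU⟩, hsrc.trans hUΩ, ?_, b,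
    hb.mono hsrc, fun x hx ↦ hbp x (hsrc hx), fun x hx ↦ hmet x (hsrc hx)⟩
  rw [contDiffGroupoid, mem_groupoid_of_pregroupoid]
  simp only [contDiffPregroupoid, modelWithCornersSelf_coe,
    modelWithCornersSelf_coe_symm, Function.comp_id, Function.id_comp, Set.preimage_id_eq, id_eq,
    Set.range_id, Set.inter_univ]
  refine ⟨hF.mono hsrc, fun y hy ↦ ContDiffAt.contDiffWithinAt ?_⟩
  have hz := hsrc (e.map_target hy)
  obtain ⟨E', hE'⟩ := hinv _ hz
  exact e.contDiffAt_symm hy (hE' ▸ hder _ hz) (hat _ hz)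

end ConformalChart

section Manifold

variable {n : ℕ} {M : Type*} [TopologicalSpace M] [ChartedSpace (Model n) M]

theorem trans_mem_maximalAtlas [IsManifold 𝓘(ℝ, Model n) ∞ M]
    {χ : OpenPartialHomeomorph M (Model n)}
    (hχ : χ ∈ IsManifold.maximalAtlas 𝓘(ℝ, Model n) ∞ M)
    {e : OpenPartialHomeomorph (Model n) (Model n)}
    (he : e ∈ contDiffGroupoid ∞ 𝓘(ℝ, Model n)) :
    χ ≫ₕ e ∈ IsManifold.maximalAtlas 𝓘(ℝ, Model n) ∞ M := by
  rw [IsManifold.maximalAtlas, mem_maximalAtlas_iff] at hχ ⊢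
  intro χ' hχ'
  obtain ⟨h1, h2⟩ := hχ χ' hχ'
  constructor
  · rw [OpenPartialHomeomorph.trans_symm_eq_symm_trans_symm, OpenPartialHomeomorph.trans_assoc]
    exact StructureGroupoid.trans _ (StructureGroupoid.symm _ he) h1
  · rw [← OpenPartialHomeomorph.trans_assoc]
    exact StructureGroupoid.trans _ h2 he

theorem chartDeriv_trans {χ : OpenPartialHomeomorph M (Model n)}
    (hχ : χ ∈ IsManifold.maximalAtlas 𝓘(ℝ, Model n) ∞ M)
    {e : OpenPartialHomeomorph (Model n) (Model n)} {p : M} (hp : p ∈ χ.source)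
    (he : DifferentiableAt ℝ e (χ p)) (v : Model n) :
    chartDeriv (χ ≫ₕ e) p v = fderiv ℝ e (χ p) (chartDeriv χ p v) := by
  have := mfderiv_comp p he.mdifferentiableAt ((mdifferentiable_of_mem hχ).mdifferentiableAt hp)
  rw [mfderiv_eq_fderiv] at this
  exact DFunLike.congr_fun this v

variable [IsManifold 𝓘(ℝ, Model n) ∞ M]
  (g : Bundle.ContMDiffRiemannianMetric 𝓘(ℝ, Model n) ∞ (Model n)
    (fun p : M ↦ TangentSpace 𝓘(ℝ, Model n) p))

theorem isGaussCodazziOn_inChart (hn : 3 ≤ n)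
    (h : SolvesGaussCodazziAtInfinity g.inner
      (raise g.inner fun p ↦ (-2 : ℝ) • schouten g.inner p))
    {χ : OpenPartialHomeomorph M (Model n)}
    (hχ : χ ∈ IsManifold.maximalAtlas 𝓘(ℝ, Model n) ∞ M) :
    IsGaussCodazziOn (BilinField.inChart g.inner χ) (fun y ↦ (-1 / 2 : ℝ) •
      EndField.inChart (raise g.inner fun p ↦ (-2 : ℝ) • schouten g.inner p) χ y) χ.target := by
  refine (isMetricOn_inChart g hχ).isGaussCodazziOn (by rwa [finrank_model])
    (contDiffOn_inChart_raise_schouten g hχ) (fun y hy ↦ inChart_raise_schouten_apply g hχ hy)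
    (fun y hy a b c d ↦ ?_) fun y hy a b ↦ ?_
  · have hg := (gauss_iff g hχ (χ.map_target hy) _ _ _ _).1 (h.gauss (χ.symm y)
      (chartSymmDeriv χ y a) (chartSymmDeriv χ y b) (chartSymmDeriv χ y c) (chartSymmDeriv χ y d))
    simpa only [chartDeriv_chartSymmDeriv hχ hy, χ.right_inv hy] using hg
  · have hd := chartDeriv_extCovDeriv g hχ (χ.map_target hy)
      (fun χ hχ ↦ contDiffOn_inChart_raise_schouten g hχ)
      (chartSymmDeriv χ y a) (chartSymmDeriv χ y b)
    have h0 : chartDeriv χ (χ.symm y) (extCovDeriv g.inner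
        (raise g.inner fun p ↦ (-2 : ℝ) • schouten g.inner p) (χ.symm y)
        (chartSymmDeriv χ y a) (chartSymmDeriv χ y b)) = 0 :=
      (congrArg (chartDeriv χ (χ.symm y)) (h.codazzi _ _ _)).trans (map_zero _)
    rw [h0] at hd
    simp only [chartDeriv_chartSymmDeriv hχ hy, χ.right_inv hy] at hd
    exact sub_eq_zero.1 hd.symm

theorem isLocallyConformallyFlat_of_solvesGaussCodazziAtInfinity (hn : 3 ≤ n)
    (h : SolvesGaussCodazziAtInfinity g.inner
      (raise g.inner fun p ↦ (-2 : ℝ) • schouten g.inner p)) :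
    IsLocallyConformallyFlat g.inner := by
  intro p
  have hχ := chartAt_mem (n := n) p
  have hp := mem_chart_source (Model n) p
  generalize chartAt (Model n) p = χ at hχ hp
  obtain ⟨e, hpe, -, he, b, hb, hbp, hG⟩ :=
    (isGaussCodazziOn_inChart g hn h hχ).exists_openPartialHomeomorph (χ.map_source hp)
  have hes : ContDiffOn ℝ ∞ e e.source :=
    contMDiffOn_iff_contDiffOn.1 (contMDiffOn_of_mem_contDiffGroupoid he)
  have hmaps : Set.MapsTo χ (χ ≫ₕ e).source e.source := fun q hq ↦ by
    rw [OpenPartialHomeomorph.trans_source] at hq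
    exact hq.2
  have hsub : (χ ≫ₕ e).source ⊆ χ.source := fun q hq ↦ by
    rw [OpenPartialHomeomorph.trans_source] at hq
    exact hq.1
  -- The conformal factor is b², so u = log b.
  refine ⟨χ ≫ₕ e, fun q ↦ Real.log (b (χ q)), ⟨trans_mem_maximalAtlas hχ he, ?_, ?_⟩, ?_⟩
  · have hl : ContDiffOn ℝ ∞ (fun x ↦ Real.log (b x)) e.source :=
      hb.log fun x hx ↦ (hbp x hx).ne'
    exact (contMDiffOn_iff_contDiffOn.2 hl).comp
      ((contMDiffOn_of_mem_maximalAtlas hχ).mono hsub) hmaps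
  · intro q hq
    have key : BilinField.at g.inner q = Real.exp (2 * Real.log (b (χ q))) •
        BilinField.at (pullbackEuclidean (χ ≫ₕ e)) q := by
      have hd := differentiableAt_of_contDiffOn e.open_source hes (hmaps hq)
      have hexp : Real.exp (2 * Real.log (b (χ q))) = b (χ q) ^ 2 := by
        rw [two_mul, Real.exp_add, Real.exp_log (hbp _ (hmaps hq)), sq]
      ext v w
      rw [BilinField.at_eq_inChart hχ _ (hsub hq), hG _ (hmaps hq), hexp, smul_apply, smul_apply,
        pullbackEuclidean_apply, chartDeriv_trans hχ (hsub hq) hd,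
        chartDeriv_trans hχ (hsub hq) hd, smul_eq_mul]
    exact key
  · rw [OpenPartialHomeomorph.trans_source]
    exact ⟨hp, hpe⟩

end Manifold

end ConfFlat

end

open ConfFlat in
theorem lemma5p1 {n : ℕ} (hn : 3 ≤ n) {M : Type*} [TopologicalSpace M]
    [ChartedSpace (EuclideanSpace ℝ (Fin n)) M]
    [IsManifold 𝓘(ℝ, EuclideanSpace ℝ (Fin n)) ∞ M]
    (g : Bundle.ContMDiffRiemannianMetric 𝓘(ℝ, EuclideanSpace ℝ (Fin n)) ∞
      (EuclideanSpace ℝ (Fin n))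
      (fun p : M ↦ TangentSpace 𝓘(ℝ, EuclideanSpace ℝ (Fin n)) p)) :
    (IsLocallyConformallyFlat g.inner →
      (∀ φ u, IsConformalChart g.inner φ u → ∀ p ∈ φ.source,
        OS g.inner p = osgoodStowe (pullbackEuclidean φ) u p) ∧
      ∀ p : M, (2 : ℝ) • OS g.inner p -
          (scalarCurvature g.inner p / ((n : ℝ) * ((n : ℝ) - 1))) • g.inner p =
        (-2 : ℝ) • schouten g.inner p) ∧
    (SolvesGaussCodazziAtInfinity g.inner
        (raise g.inner (fun p ↦ (-2 : ℝ) • schouten g.inner p)) ↔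
      IsLocallyConformallyFlat g.inner) := by
  exact ⟨fun h ↦ ⟨fun φ u hc p hp ↦ OS_eq g hn hc hp, fun p ↦ by
      obtain ⟨φ, u, hc, hp⟩ := h p
      rw [OS_eq g hn hc hp]
      exact two_smul_osgoodStowe_sub g hn hc hp⟩,
    isLocallyConformallyFlat_of_solvesGaussCodazziAtInfinity g hn,
    solvesGaussCodazziAtInfinity_of_isLocallyConformallyFlat g hn⟩
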